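/- Let $d\ge 2$, and let $\mathscr W$ be a finite or countable collection of nonzero linear subspaces of $\mathbb R^d$. Then for every $s\in[0,1]$ there exists a compact set $\Gamma\subseteq[0,1]^d$ with $\dim_H\Gamma=d-s$ such that, for every $w\in\mathscr W$, the orthogonal projection $\pi_w:\mathbb R^d\to w$ is injective on $\Gamma$ and $\dim_H \pi_w(\Gamma)=\dim w-s$. Here $\mathbb R^d$ carries the Euclidean metric, $\dim_H$ denotes Hausdorff dimension, and $\dim w$ is the linear dimension of $w$. -/

import Mathlib

/-- The closed unit cube `[0,1]^d` in Euclidean space `ℝ^d`. -/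
def unitCube (d : ℕ) : Set (EuclideanSpace ℝ (Fin d)) :=
  {x | ∀ i, x i ∈ Set.Icc (0 : ℝ) 1}

open MeasureTheory Measure Set Filter Topology
open scoped ENNReal NNReal

/-! It is enough to control one line in each subspace. Pick a unit vector `e n` in every subspace
and build a compact Γ in the cube, of dimension at least d - s, on which each functional ⟪e n, ·⟫ is
injective with image of dimension at most 1 - s. The functional factors through the projection to w,
which is therefore injective on Γ. A linear map lowers the dimension of a bounded set by at most the
dimension of its kernel (`dimH_le_dimH_image_add_finrank_ker`). For the functional on w this gives
dim π_w(Γ) ≤ dim w - s; for π_w it gives d - s ≤ dim Γ ≤ dim π_w(Γ) + d - dim w. Hence all of these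
are equalities.

Γ is the intersection of the nested supports of continuous densities. One step
(`IsFrostmanDensity.exists_refinement`) multiplies the density by bumps in ⟪e, x⟫ of mean one and
period 4δ^a, living on slabs of thickness at most δ. Such slabs push the dimension of the image down
to a, and a tends to 1 - s along the steps. Two copies of the bump, half a period apart, are used on
the two pieces of a partition of unity, so that points of different pieces get different values.
Countably many directions and partitions are treated in turn.

The dimension survives because one Frostman bound does (`IsFrostmanDensity.exists_forall_mul`).
Above a threshold radius the bumps average out as δ → 0. Below it they give balls mass O(r^(n+a-1)),
n the dimension of the space, with a constant depending on the current density; the logarithm in the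
gauge absorbs that constant and costs no dimension. -/

/-! ### Hausdorff dimension and fibres of linear maps -/

/-- Diameters may vanish, so each is replaced by a slightly larger positive `δ n`, at a
geometrically small cost; the `δ n` later serve as side lengths and radii. -/
theorem exists_cover_of_hausdorffMeasure_eq_zero {X : Type*} [MetricSpace X] [MeasurableSpace X]
    [BorelSpace X] {q : ℝ} (hq : 0 < q) {A : Set X} (hA : μH[q] A = 0) {ε : ℝ} (hε : 0 < ε) :
    ∃ (t : ℕ → Set X) (δ : ℕ → ℝ), (∀ n, 0 < δ n ∧ δ n ≤ ε) ∧
      (∀ n, Metric.ediam (t n) ≤ ENNReal.ofReal (δ n)) ∧ A ⊆ ⋃ n, t n ∧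
      ∑' n, ENNReal.ofReal (δ n ^ q) ≤ ENNReal.ofReal ε := by
  have hε2 : 0 < ENNReal.ofReal (ε / 2) := by simpa using hε
  rw [hausdorffMeasure_apply] at hA
  simp only [ENNReal.iSup_eq_zero] at hA
  have h1 := hA (ENNReal.ofReal (ε / 2)) hε2
  have h2 : (⨅ (t : ℕ → Set X) (_ : A ⊆ ⋃ n, t n)
      (_ : ∀ n, Metric.ediam (t n) ≤ ENNReal.ofReal (ε / 2)),
      ∑' n, ⨆ _ : (t n).Nonempty, Metric.ediam (t n) ^ q) < ENNReal.ofReal (ε / 2) := by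
    rw [h1]; exact hε2
  simp only [iInf_lt_iff] at h2
  obtain ⟨t, hAt, hdiam, hsum⟩ := h2
  set D : ℕ → ℝ := fun n => (Metric.ediam (t n)).toReal with hD
  have hfin : ∀ n, Metric.ediam (t n) ≠ ∞ := fun n =>
    ne_top_of_le_ne_top ENNReal.ofReal_ne_top (hdiam n)
  have hDle : ∀ n, D n ≤ ε / 2 := fun n =>
    ENNReal.toReal_le_of_le_ofReal (by positivity) (hdiam n)
  have hDdiam : ∀ n, ENNReal.ofReal (D n) = Metric.ediam (t n) := fun n =>
    ENNReal.ofReal_toReal (hfin n)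
  have key : ∀ n, ∃ δ, D n < δ ∧ δ ≤ ε ∧ δ ^ q ≤ D n ^ q + (ε / 2) * (1 / 2) ^ (n + 1) := by
    intro n
    have hc : ContinuousAt (fun x : ℝ => x ^ q) (D n) :=
      Real.continuousAt_rpow_const _ _ (Or.inr hq.le)
    have e1 : ∀ᶠ x in 𝓝[>] (D n), x ^ q < D n ^ q + (ε / 2) * (1 / 2) ^ (n + 1) :=
      (hc.mono_left nhdsWithin_le_nhds).eventually_lt_const
        (lt_add_of_pos_right _ (by positivity))
    have e2 : ∀ᶠ x in 𝓝[>] (D n), x < ε :=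
      nhdsWithin_le_nhds (Iio_mem_nhds (by have := hDle n; linarith))
    obtain ⟨x, h1, h2, h3⟩ := (e1.and (e2.and self_mem_nhdsWithin)).exists
    exact ⟨x, h3, h2.le, h1.le⟩
  choose δ hδ1 hδ2 hδ3 using key
  have hD0 : ∀ n, 0 ≤ D n := fun n => ENNReal.toReal_nonneg
  refine ⟨t, δ, fun n => ⟨(hD0 n).trans_lt (hδ1 n), hδ2 n⟩, fun n => ?_, hAt, ?_⟩
  · rw [← hDdiam n]; exact ENNReal.ofReal_le_ofReal (hδ1 n).le
  · calc ∑' n, ENNReal.ofReal (δ n ^ q)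
        ≤ ∑' n, ((⨆ _ : (t n).Nonempty, Metric.ediam (t n) ^ q)
            + ENNReal.ofReal ((ε / 2) * (1 / 2) ^ (n + 1))) := by
          refine ENNReal.tsum_le_tsum fun n => ?_
          refine (ENNReal.ofReal_le_ofReal (hδ3 n)).trans ?_
          rw [ENNReal.ofReal_add (by have := hD0 n; positivity) (by positivity)]
          gcongr
          rw [← ENNReal.ofReal_rpow_of_nonneg (hD0 n) hq.le, hDdiam n]
          rcases (t n).eq_empty_or_nonempty with h | h
          · simp [h, hq]
          · simp [h]
      _ = (∑' n, ⨆ _ : (t n).Nonempty, Metric.ediam (t n) ^ q)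
            + ∑' n : ℕ, ENNReal.ofReal ((ε / 2) * (1 / 2) ^ (n + 1)) := ENNReal.tsum_add
      _ ≤ ENNReal.ofReal (ε / 2) + ENNReal.ofReal (ε / 2) := by
          gcongr
          rw [← ENNReal.ofReal_tsum_of_nonneg (fun n => by positivity)]
          · rw [tsum_mul_left]
            have : ∑' n : ℕ, (1 / 2 : ℝ) ^ (n + 1) = 1 := by
              simp only [pow_succ]; rw [tsum_mul_right, tsum_geometric_two]; norm_num
            rw [this, mul_one]
          · exact ((summable_nat_add_iff 1).2 summable_geometric_two).mul_left _
      _ = ENNReal.ofReal ε := by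
          rw [← ENNReal.ofReal_add (by positivity) (by positivity), add_halves]

/-- Over a covering set of size δ, the bounded factor is cut into O(δ^(-k)) cubes of side δ.
Together they contribute O(δ^(-k)) δ^(q+k) = O(δ^q), which is summably small. -/
theorem hausdorffMeasure_eq_zero_of_fst {Y : Type*} [MetricSpace Y]
    [MeasurableSpace Y] [BorelSpace Y] {k : ℕ} [MeasurableSpace (Y × (Fin k → ℝ))]
    [BorelSpace (Y × (Fin k → ℝ))] {S : Set (Y × (Fin k → ℝ))} {R : ℝ} (hR : 0 ≤ R)
    (hS : ∀ x ∈ S, ∀ i, x.2 i ∈ Icc (-R) R) {q : ℝ} (hq : 0 < q)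
    (h : μH[q] (Prod.fst '' S) = 0) : μH[q + k] S = 0 := by
  have hx : ∀ j : ℕ, 0 < (1 : ℝ) / (j + 1) := fun j => by positivity
  choose t δ hδ hdiam hcov hsum using
    fun j : ℕ => exists_cover_of_hausdorffMeasure_eq_zero hq h (hx j)
  -- The index of a cube is a floor that can equal the ceiling itself, hence the `+ 1`.
  let N : ℕ → ℕ → ℕ := fun j n => ⌈2 * R / δ j n⌉₊ + 1
  let c : ∀ j : ℕ, (Σ n : ℕ, (Fin k → Fin (N j n))) → Set (Y × (Fin k → ℝ)) := fun j i =>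
    t j i.1 ×ˢ Set.pi univ fun l =>
      Icc (-R + (i.2 l : ℕ) * δ j i.1) (-R + ((i.2 l : ℕ) + 1) * δ j i.1)
  have hcd : ∀ j i, Metric.ediam (c j i) ≤ ENNReal.ofReal (δ j i.1) := by
    intro j i
    refine Metric.ediam_le fun x hx y hy => ?_
    rw [Prod.edist_eq]
    refine max_le ((Metric.edist_le_ediam_of_mem hx.1 hy.1).trans (hdiam j i.1)) ?_
    rw [edist_pi_le_iff]
    intro l
    have h1 := hx.2 l (mem_univ l)
    have h2 := hy.2 l (mem_univ l)
    rw [edist_dist]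
    refine ENNReal.ofReal_le_ofReal ?_
    rw [Real.dist_eq, abs_le]
    constructor <;> linarith [h1.1, h1.2, h2.1, h2.2]
  have hb := hausdorffMeasure_le_liminf_tsum (q + k) S (l := atTop)
    (fun j : ℕ => ENNReal.ofReal (1 / (j + 1))) (by
      rw [← ENNReal.ofReal_zero]
      exact ENNReal.tendsto_ofReal tendsto_one_div_add_atTop_nhds_zero_nat) c
    (Eventually.of_forall fun j i =>
      (hcd j i).trans (ENNReal.ofReal_le_ofReal (hδ j i.1).2))
    (Eventually.of_forall fun j x hxS => by
      obtain ⟨n, hn⟩ := mem_iUnion.1 (hcov j (mem_image_of_mem _ hxS))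
      have hpos := (hδ j n).1
      have hlt : ∀ l, ⌊(x.2 l + R) / δ j n⌋₊ < N j n := fun l => by
        have h2 := (hS x hxS l).2
        refine Nat.lt_succ_of_le ((Nat.floor_le_floor ?_).trans (Nat.floor_le_ceil _))
        gcongr; linarith
      refine mem_iUnion.2 ⟨⟨n, fun l => ⟨_, hlt l⟩⟩, hn, fun l _ => ?_⟩
      have h1 := (hS x hxS l).1
      have h3 : 0 ≤ (x.2 l + R) / δ j n := div_nonneg (by linarith) hpos.le
      have h4 := Nat.floor_le h3
      have h5 := Nat.lt_floor_add_one ((x.2 l + R) / δ j n)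
      rw [le_div_iff₀ hpos] at h4
      rw [div_lt_iff₀ hpos] at h5
      exact ⟨by dsimp only; linarith, by dsimp only; linarith⟩)
  have hlim : Tendsto (fun j : ℕ => ENNReal.ofReal ((2 * R + 2) ^ k * (1 / (j + 1)))) atTop (𝓝 0) := by
    rw [← ENNReal.ofReal_zero]
    refine ENNReal.tendsto_ofReal ?_
    simpa using (tendsto_one_div_add_atTop_nhds_zero_nat (𝕜 := ℝ)).const_mul ((2 * R + 2) ^ k)
  refine le_antisymm (hb.trans ?_) (zero_le)
  rw [← hlim.liminf_eq]
  refine liminf_le_liminf (Eventually.of_forall fun j => ?_)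
  rw [ENNReal.tsum_sigma', ENNReal.ofReal_mul (by positivity)]
  refine le_trans ?_ (mul_le_mul_right (hsum j) _)
  rw [← ENNReal.tsum_mul_left]
  refine ENNReal.tsum_le_tsum fun n => ?_
  have hpos := (hδ j n).1
  have hle1 : δ j n ≤ 1 := (hδ j n).2.trans (by
    rw [div_le_one (by positivity)]; linarith [(Nat.cast_nonneg j : (0:ℝ) ≤ j)])
  calc ∑' b : Fin k → Fin (N j n), Metric.ediam (c j ⟨n, b⟩) ^ (q + k)
      ≤ ∑' b : Fin k → Fin (N j n), ENNReal.ofReal (δ j n ^ (q + k)) := by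
        refine ENNReal.tsum_le_tsum fun b => ?_
        rw [← ENNReal.ofReal_rpow_of_pos hpos]
        exact ENNReal.rpow_le_rpow (hcd j ⟨n, b⟩) (by positivity)
    _ = ENNReal.ofReal ((N j n : ℝ) ^ k * δ j n ^ (q + k)) := by
        rw [tsum_fintype, Finset.sum_const, Finset.card_univ, Fintype.card_fun, nsmul_eq_mul,
          Fintype.card_fin, Fintype.card_fin, ENNReal.ofReal_mul (by positivity),
          ← Nat.cast_pow (α := ℝ), ENNReal.ofReal_natCast]
    _ ≤ _ := by
        rw [← ENNReal.ofReal_mul (by positivity)]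
        refine ENNReal.ofReal_le_ofReal ?_
        have hN : (N j n : ℝ) * δ j n ≤ 2 * R + 2 := by
          have : (N j n : ℝ) ≤ 2 * R / δ j n + 2 := by
            have := Nat.ceil_lt_add_one (a := 2 * R / δ j n) (by positivity)
            simp only [N]; push_cast; linarith
          calc (N j n : ℝ) * δ j n ≤ (2 * R / δ j n + 2) * δ j n := by gcongr
            _ = 2 * R + 2 * δ j n := by field_simp
            _ ≤ _ := by linarith
        rw [add_comm q, Real.rpow_add hpos, Real.rpow_natCast, ← mul_assoc, ← mul_pow]
        gcongr

theorem dimH_le_dimH_image_fst_add {Y : Type*} [MetricSpace Y] {k : ℕ}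
    {S : Set (Y × (Fin k → ℝ))} (hS : Bornology.IsBounded S) :
    dimH S ≤ dimH (Prod.fst '' S) + k := by
  borelize Y
  borelize (Y × (Fin k → ℝ))
  obtain ⟨R, hR0, hR⟩ : ∃ R : ℝ, 0 ≤ R ∧ ∀ x ∈ S, ∀ i, x.2 i ∈ Icc (-R) R := by
    have hb : Bornology.IsBounded (Prod.snd '' S) := hS.image_snd
    obtain ⟨R, hR⟩ := hb.subset_closedBall 0
    refine ⟨max R 0, le_max_right _ _, fun x hx i => ?_⟩
    have h1 : ‖x.2‖ ≤ R := by simpa using hR (mem_image_of_mem _ hx)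
    have h2 := (norm_le_pi_norm x.2 i).trans (h1.trans (le_max_left R 0))
    exact abs_le.1 h2
  refine ENNReal.le_of_forall_pos_le_add fun ε hε hfin => ?_
  have hfin' : dimH (Prod.fst '' S) ≠ ∞ := fun h => by simp [h] at hfin
  lift dimH (Prod.fst '' S) to ℝ≥0 using hfin' with q hq
  have h0 : μH[((q + ε : ℝ≥0) : ℝ)] (Prod.fst '' S) = 0 := by
    refine hausdorffMeasure_of_dimH_lt ?_
    rw [← hq]; exact_mod_cast lt_add_of_pos_right q hε
  have h1 := hausdorffMeasure_eq_zero_of_fst hR0 hR (by positivity) h0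
  have h2 : dimH S ≤ ((q + ε + k : ℝ≥0) : ℝ≥0∞) := by
    refine dimH_le_of_hausdorffMeasure_ne_top ?_
    push_cast at h1 ⊢
    rw [h1]; simp
  refine h2.trans (le_of_eq ?_)
  push_cast; ring

theorem dimH_le_dimH_image_add_finrank_ker {V Y : Type*} [NormedAddCommGroup V] [NormedSpace ℝ V]
    [FiniteDimensional ℝ V] [NormedAddCommGroup Y] [NormedSpace ℝ Y] [FiniteDimensional ℝ Y]
    (T : V →ₗ[ℝ] Y) {S : Set V} (hS : Bornology.IsBounded S) :
    dimH S ≤ dimH (T '' S) + Module.finrank ℝ (LinearMap.ker T) := by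
  -- A linear retraction `P` onto the kernel makes `(T, P)` injective, hence antilipschitz, which
  -- reduces the claim to a product.
  obtain ⟨P, hP⟩ := (LinearMap.ker T).subtype.exists_leftInverse_of_injective
    (Submodule.ker_subtype _)
  let L : V →ₗ[ℝ] Y × (Fin (Module.finrank ℝ (LinearMap.ker T)) → ℝ) :=
    T.prod ((Module.finBasis ℝ (LinearMap.ker T)).equivFun.toLinearMap ∘ₗ P)
  have hL : LinearMap.ker L = ⊥ := by
    rw [LinearMap.ker_eq_bot']
    intro v hv
    have h1 : T v = 0 := congrArg Prod.fst hv
    have h2 : (Module.finBasis ℝ (LinearMap.ker T)).equivFun (P v) = 0 := congrArg Prod.snd hv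
    rw [LinearEquiv.map_eq_zero_iff] at h2
    have h3 := LinearMap.congr_fun hP ⟨v, h1⟩
    simp only [LinearMap.comp_apply, Submodule.subtype_apply, h2, LinearMap.id_apply] at h3
    exact (congrArg Subtype.val h3).symm
  obtain ⟨K, -, hK⟩ := L.exists_antilipschitzWith hL
  have hb : Bornology.IsBounded (L '' S) :=
    (LinearMap.toContinuousLinearMap L).lipschitz.isBounded_image hS
  refine (hK.le_dimH_image S).trans ((dimH_le_dimH_image_fst_add hb).trans (le_of_eq ?_))
  rw [image_image]
  rfl

/-! ### Periodic bumps on the line -/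

/-- A tent of half-width δ on the circle, rescaled to mean one. The tent is at least 1/2 on an
interval of length δ/2, so its integral is at least δ/4, whence the bound on the height. -/
theorem exists_periodic_bump {δ ρ : ℝ} (hδ : 0 < δ) (hδρ : δ ≤ ρ) :
    ∃ G : ℝ → ℝ≥0, Continuous G ∧
      (∀ u, ∫⁻ v in Ioc u (u + ρ), (G v : ℝ≥0∞) = ENNReal.ofReal ρ) ∧
      (∀ u, (G u : ℝ≥0∞) ≤ ENNReal.ofReal (4 * ρ / δ)) ∧
      ∀ u, G u ≠ 0 → ‖(u : AddCircle ρ)‖ ≤ δ := by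
  have hρ : 0 < ρ := by linarith
  have : Fact (0 < ρ) := ⟨hρ⟩
  let B : AddCircle ρ → ℝ≥0 := fun x => (1 - ‖x‖ / δ).toNNReal
  have hBc : Continuous B := by fun_prop
  have hB1 : ∀ x, B x ≤ 1 := fun x => by
    simp only [B, Real.toNNReal_le_one]
    have : 0 ≤ ‖x‖ / δ := by positivity
    linarith
  let I : ℝ≥0∞ := ∫⁻ x : AddCircle ρ, (B x : ℝ≥0∞)
  have hI : ∀ u, ∫⁻ v in Ioc u (u + ρ), (B (v : AddCircle ρ) : ℝ≥0∞) = I := fun u =>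
    AddCircle.lintegral_preimage ρ u fun x => (B x : ℝ≥0∞)
  have hIlow : ENNReal.ofReal (δ / 4) ≤ I := by
    rw [← hI 0]
    calc ENNReal.ofReal (δ / 4) = ∫⁻ v in Ioc 0 (δ / 2), ENNReal.ofReal (1 / 2) := by
          rw [setLIntegral_const, Real.volume_Ioc, ← ENNReal.ofReal_mul (by norm_num)]
          congr 1; ring
      _ ≤ ∫⁻ v in Ioc 0 (δ / 2), (B (v : AddCircle ρ) : ℝ≥0∞) := by
          refine setLIntegral_mono' measurableSet_Ioc fun v hv => ?_
          rw [ENNReal.ofReal]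
          refine ENNReal.coe_le_coe.2 (Real.toNNReal_le_toNNReal ?_)
          have h1 : ‖(v : AddCircle ρ)‖ ≤ δ / 2 := by
            refine (QuotientAddGroup.norm_mk_le_norm).trans ?_
            rw [Real.norm_eq_abs, abs_of_pos hv.1]; exact hv.2
          have : ‖(v : AddCircle ρ)‖ / δ ≤ 1 / 2 := by rw [div_le_iff₀ hδ]; linarith
          linarith
      _ ≤ _ := lintegral_mono_set (Ioc_subset_Ioc_right (by linarith))
  have hIpos : I ≠ 0 := fun h => by
    rw [h] at hIlow
    simp only [nonpos_iff_eq_zero, ENNReal.ofReal_eq_zero] at hIlow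
    linarith
  have hIfin : I ≠ ∞ := by
    rw [← hI 0]
    refine ne_top_of_le_ne_top (b := ENNReal.ofReal ρ) ENNReal.ofReal_ne_top ?_
    calc _ ≤ ∫⁻ v in Ioc 0 (0 + ρ), (1 : ℝ≥0∞) :=
          lintegral_mono fun v => ENNReal.coe_le_one_iff.2 (hB1 _)
      _ = _ := by simp
  obtain ⟨J, hJ⟩ : ∃ J : ℝ≥0, (J : ℝ≥0∞) = ENNReal.ofReal ρ / I :=
    ⟨_, ENNReal.coe_toNNReal (ENNReal.div_ne_top ENNReal.ofReal_ne_top hIpos)⟩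
  refine ⟨fun u => J * B u, continuous_const.mul (hBc.comp (AddCircle.continuous_mk' ρ)),
    fun u => ?_, fun u => ?_, fun u hu => ?_⟩
  · simp only [ENNReal.coe_mul]
    rw [lintegral_const_mul' _ _ ENNReal.coe_ne_top, hI, hJ, ENNReal.div_mul_cancel hIpos hIfin]
  · push_cast
    calc (J : ℝ≥0∞) * B u ≤ J * 1 := by gcongr; exact_mod_cast hB1 _
      _ ≤ ENNReal.ofReal ρ / ENNReal.ofReal (δ / 4) := by rw [mul_one, hJ]; gcongr
      _ = ENNReal.ofReal (4 * ρ / δ) := by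
        rw [← ENNReal.ofReal_div_of_pos (by positivity)]; congr 1; field_simp
  · have h1 : B u ≠ 0 := fun h => hu (by simp [h])
    have h2 : 0 < 1 - ‖(u : AddCircle ρ)‖ / δ := by
      by_contra h
      exact h1 (Real.toNNReal_of_nonpos (not_lt.1 h))
    have h3 : ‖(u : AddCircle ρ)‖ < δ := by
      rw [sub_pos, div_lt_one hδ] at h2; exact h2
    exact h3.le

theorem setLIntegral_Ioc_add_nat_mul {G : ℝ → ℝ≥0∞} {ρ : ℝ} (hρ : 0 ≤ ρ)
    (hG : ∀ u, ∫⁻ v in Ioc u (u + ρ), G v = ENNReal.ofReal ρ) (n : ℕ) (u : ℝ) :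
    ∫⁻ v in Ioc u (u + n * ρ), G v = ENNReal.ofReal (n * ρ) := by
  induction n with
  | zero => simp
  | succ n ih =>
    have h1 : Ioc u (u + (n + 1 : ℕ) * ρ) =
        Ioc u (u + n * ρ) ∪ Ioc (u + n * ρ) (u + n * ρ + ρ) := by
      rw [Ioc_union_Ioc_eq_Ioc (by nlinarith [(Nat.cast_nonneg n : (0 : ℝ) ≤ n)]) (by linarith)]
      congr 1; push_cast; ring
    rw [h1, lintegral_union measurableSet_Ioc (Ioc_disjoint_Ioc_of_le le_rfl), ih, hG,
      ← ENNReal.ofReal_add (by positivity) hρ]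
    congr 1; push_cast; ring

/-- Three scales: for r ≤ δ the height bound suffices, as δ^(a-1) ≤ r^(a-1); for r between δ and the
period, one whole period has mass 4δ^a ≤ 4r^a; beyond that, whole periods cover a length at most 2r
≤ 2r^a. -/
theorem setLIntegral_Ioc_le_rpow {G : ℝ → ℝ≥0∞} {a δ : ℝ} (ha0 : 0 < a) (ha1 : a ≤ 1)
    (hδ : 0 < δ)
    (hG : ∀ u, ∫⁻ v in Ioc u (u + 4 * δ ^ a), G v = ENNReal.ofReal (4 * δ ^ a))
    (hsup : ∀ u, G u ≤ ENNReal.ofReal (8 * (4 * δ ^ a) / δ)) {r : ℝ} (hr : 0 < r) (hr1 : r ≤ 1)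
    (u : ℝ) : ∫⁻ v in Ioc u (u + r), G v ≤ ENNReal.ofReal (32 * r ^ a) := by
  have hρ : 0 < 4 * δ ^ a := by positivity
  rcases le_total r δ with h1 | h1
  · calc ∫⁻ v in Ioc u (u + r), G v
        ≤ ∫⁻ v in Ioc u (u + r), ENNReal.ofReal (8 * (4 * δ ^ a) / δ) :=
          lintegral_mono fun v => hsup v
      _ = ENNReal.ofReal (32 * (δ ^ (a - 1) * r)) := by
          rw [setLIntegral_const, Real.volume_Ioc, ← ENNReal.ofReal_mul (by positivity),
            Real.rpow_sub_one hδ.ne']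
          congr 1; ring
      _ ≤ _ := by
          refine ENNReal.ofReal_le_ofReal ?_
          have h2 : δ ^ (a - 1) ≤ r ^ (a - 1) :=
            Real.rpow_le_rpow_of_nonpos hr h1 (by linarith)
          have h3 : r ^ a = r ^ (a - 1) * r := by
            rw [Real.rpow_sub_one hr.ne']; field_simp
          rw [h3]; gcongr
  rcases le_total r (4 * δ ^ a) with h2 | h2
  · calc ∫⁻ v in Ioc u (u + r), G v ≤ ∫⁻ v in Ioc u (u + 4 * δ ^ a), G v :=
          lintegral_mono_set (Ioc_subset_Ioc_right (by linarith))
      _ = _ := hG u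
      _ ≤ _ := by
          refine ENNReal.ofReal_le_ofReal ?_
          have : δ ^ a ≤ r ^ a := Real.rpow_le_rpow hδ.le h1 ha0.le
          have : 0 < r ^ a := by positivity
          linarith
  · set n := ⌈r / (4 * δ ^ a)⌉₊
    have hn1 : r ≤ n * (4 * δ ^ a) := by
      rw [← div_le_iff₀ hρ]; exact Nat.le_ceil _
    have hn2 : n * (4 * δ ^ a) ≤ 2 * r := by
      have := (Nat.ceil_lt_add_one (a := r / (4 * δ ^ a)) (by positivity)).le
      calc n * (4 * δ ^ a) ≤ (r / (4 * δ ^ a) + 1) * (4 * δ ^ a) := by gcongr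
        _ = r + 4 * δ ^ a := by field_simp
        _ ≤ _ := by linarith
    calc ∫⁻ v in Ioc u (u + r), G v ≤ ∫⁻ v in Ioc u (u + n * (4 * δ ^ a)), G v :=
          lintegral_mono_set (Ioc_subset_Ioc_right (by linarith))
      _ = _ := setLIntegral_Ioc_add_nat_mul hρ.le hG n u
      _ ≤ _ := by
          refine ENNReal.ofReal_le_ofReal ?_
          have : r ≤ r ^ a := by
            simpa using Real.rpow_le_rpow_of_exponent_ge hr hr1 ha1
          linarith

theorem setLIntegral_Ioc_comp_add_left (G : ℝ → ℝ≥0∞) (u L : ℝ) :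
    ∫⁻ h in Ioc 0 L, G (u + h) = ∫⁻ v in Ioc u (u + L), G v := by
  rw [← lintegral_indicator measurableSet_Ioc, ← lintegral_indicator measurableSet_Ioc,
    ← lintegral_add_left_eq_self ((Ioc u (u + L)).indicator G) u]
  refine lintegral_congr fun h => ?_
  simp [indicator, mem_Ioc]

/-! ### Averaging along a direction -/

section Averaging

variable {E : Type*} [NormedAddCommGroup E] [InnerProductSpace ℝ E] [FiniteDimensional ℝ E]
  [MeasurableSpace E] [BorelSpace E]

/-- By translation invariance the inner integral over x does not depend on h; averaging over h lets
the integral of `G` over an interval replace its pointwise values. -/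
theorem ofReal_mul_lintegral_mul_inner {e : E} (he : ‖e‖ = 1) {F : E → ℝ≥0∞} (hF : Measurable F)
    {G : ℝ → ℝ≥0∞} (hG : Measurable G) (L : ℝ) :
    ENNReal.ofReal L * ∫⁻ x, F x * G (inner ℝ e x) =
      ∫⁻ x, ∫⁻ h in Ioc 0 L, F (x + h • e) * G (inner ℝ e x + h) := by
  rw [lintegral_lintegral_swap]
  · have : ∀ h : ℝ, ∫⁻ x, F (x + h • e) * G (inner ℝ e x + h) =
        ∫⁻ x, F x * G (inner ℝ e x) := fun h => by
      rw [← lintegral_add_right_eq_self (fun x => F x * G (inner ℝ e x)) (h • e)]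
      refine lintegral_congr fun x => ?_
      rw [inner_add_right, inner_smul_right, real_inner_self_eq_norm_sq, he]
      simp
    simp_rw [this]
    rw [setLIntegral_const, Real.volume_Ioc, sub_zero, mul_comm]
  · refine Measurable.aemeasurable ?_
    exact (hF.comp (by fun_prop)).mul (hG.comp (by fun_prop))

theorem ofReal_mul_lintegral_mul_inner_le {e : E} (he : ‖e‖ = 1) {F F' : E → ℝ≥0∞}
    (hF : Measurable F) (hF' : Measurable F')
    {G : ℝ → ℝ≥0∞} (hG : Measurable G) {L : ℝ} {B : ℝ≥0∞}
    (hB : ∀ u, ∫⁻ v in Ioc u (u + L), G v ≤ B)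
    (hFF' : ∀ x, ∀ h ∈ Ioc 0 L, F (x + h • e) ≤ F' x) :
    ENNReal.ofReal L * ∫⁻ x, F x * G (inner ℝ e x) ≤ B * ∫⁻ x, F' x := by
  rw [ofReal_mul_lintegral_mul_inner he hF hG, ← lintegral_const_mul _ hF']
  refine lintegral_mono fun x => ?_
  calc ∫⁻ h in Ioc 0 L, F (x + h • e) * G (inner ℝ e x + h)
      ≤ ∫⁻ h in Ioc 0 L, F' x * G (inner ℝ e x + h) :=
        setLIntegral_mono' measurableSet_Ioc fun h hh => by gcongr; exact hFF' x h hh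
    _ = F' x * ∫⁻ h in Ioc 0 L, G (inner ℝ e x + h) :=
        lintegral_const_mul _ (hG.comp (by fun_prop))
    _ ≤ _ := by
        rw [setLIntegral_Ioc_comp_add_left, mul_comm]; gcongr; exact hB _

theorem le_ofReal_mul_lintegral_mul_inner {e : E} (he : ‖e‖ = 1) {F F' : E → ℝ≥0∞}
    (hF : Measurable F) (hF' : Measurable F')
    {G : ℝ → ℝ≥0∞} (hG : Measurable G) {L : ℝ} {B : ℝ≥0∞}
    (hB : ∀ u, B ≤ ∫⁻ v in Ioc u (u + L), G v)
    (hFF' : ∀ x, ∀ h ∈ Ioc 0 L, F' x ≤ F (x + h • e)) :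
    B * ∫⁻ x, F' x ≤ ENNReal.ofReal L * ∫⁻ x, F x * G (inner ℝ e x) := by
  rw [ofReal_mul_lintegral_mul_inner he hF hG, ← lintegral_const_mul _ hF']
  refine lintegral_mono fun x => ?_
  calc B * F' x ≤ F' x * ∫⁻ h in Ioc 0 L, G (inner ℝ e x + h) := by
        rw [setLIntegral_Ioc_comp_add_left, mul_comm]; gcongr; exact hB _
    _ = ∫⁻ h in Ioc 0 L, F' x * G (inner ℝ e x + h) :=
        (lintegral_const_mul _ (hG.comp (by fun_prop))).symm
    _ ≤ _ := setLIntegral_mono' measurableSet_Ioc fun h hh => by gcongr; exact hFF' x h hh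

end Averaging

/-! ### The logarithmic gauge -/

/-- The gauge `r ^ p` with a logarithmic correction. -/
noncomputable def logGauge (p r : ℝ) : ℝ := r ^ p * (1 + Real.log (1 + 1 / r))

theorem log_one_add_inv_nonneg {r : ℝ} (hr : 0 < r) : 0 ≤ Real.log (1 + 1 / r) :=
  Real.log_nonneg (by have : 0 < 1 / r := by positivity
                      linarith)

theorem rpow_le_logGauge {p r : ℝ} (hr : 0 < r) : r ^ p ≤ logGauge p r :=
  le_mul_of_one_le_right (by positivity) (by linarith [log_one_add_inv_nonneg hr])

theorem logGauge_add_le {p r s : ℝ} (hr : 0 < r) (hs : 0 ≤ s) :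
    logGauge p (r + s) ≤ (1 + s / r) ^ p * logGauge p r := by
  have h1 : (r + s) ^ p = (1 + s / r) ^ p * r ^ p := by
    rw [← Real.mul_rpow (by positivity) hr.le]; congr 1; field_simp
  have h2 : Real.log (1 + 1 / (r + s)) ≤ Real.log (1 + 1 / r) := by
    apply Real.log_le_log (by positivity)
    gcongr; linarith
  rw [logGauge, logGauge, h1, mul_assoc]
  gcongr

/-- The purpose of the logarithm: at small radii it beats any constant, however large. -/
theorem exists_forall_mul_rpow_le_logGauge (p C : ℝ) {B : ℝ} (hB : 0 < B) :
    ∃ R, 0 < R ∧ R ≤ 1 ∧ ∀ r, 0 < r → r ≤ R → C * r ^ p ≤ B * logGauge p r := by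
  refine ⟨min 1 (Real.exp (-(C / B))), by positivity, min_le_left _ _, fun r hr hrR => ?_⟩
  have h1 : C / B ≤ Real.log (1 + 1 / r) := by
    rw [Real.le_log_iff_exp_le (by positivity)]
    have h2 : r ≤ Real.exp (-(C / B)) := hrR.trans (min_le_right _ _)
    have h3 : Real.exp (C / B) ≤ 1 / r := by
      rw [le_div_iff₀ hr]
      calc Real.exp (C / B) * r ≤ Real.exp (C / B) * Real.exp (-(C / B)) := by gcongr
        _ = 1 := by rw [← Real.exp_add]; simp
    linarith
  rw [div_le_iff₀ hB] at h1
  have h4 : 0 < r ^ p := by positivity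
  rw [logGauge]
  nlinarith

/-- The logarithm is weaker than any power, so the gauge still detects dimension p. -/
theorem logGauge_le_rpow {p q : ℝ} (hqp : q < p) :
    ∃ C, 0 ≤ C ∧ ∀ r, 0 < r → r ≤ 1 → logGauge p r ≤ C * r ^ q := by
  refine ⟨1 + 2 ^ (p - q) / (p - q), by have := sub_pos.2 hqp; positivity, fun r hr hr1 => ?_⟩
  have hη := sub_pos.2 hqp
  have h1 : Real.log (1 + 1 / r) ≤ (2 / r) ^ (p - q) / (p - q) := by
    refine (Real.log_le_rpow_div (by positivity) hη).trans ?_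
    have : 1 + 1 / r ≤ 2 / r := by
      rw [add_div' _ _ _ hr.ne', one_mul]
      gcongr; linarith
    gcongr
  have h2 : r ^ p = r ^ q * r ^ (p - q) := by
    rw [← Real.rpow_add hr]; congr 1; ring
  have h3 : r ^ (p - q) ≤ 1 := Real.rpow_le_one hr.le hr1 hη.le
  calc logGauge p r ≤ r ^ p * (1 + (2 / r) ^ (p - q) / (p - q)) := by
        rw [logGauge]; gcongr
    _ = r ^ q * (r ^ (p - q) + 2 ^ (p - q) / (p - q)) := by
        rw [h2, Real.div_rpow (by norm_num) hr.le]
        have : 0 < r ^ (p - q) := by positivity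
        field_simp
    _ ≤ r ^ q * (1 + 2 ^ (p - q) / (p - q)) := by gcongr
    _ = _ := mul_comm _ _

theorem setLIntegral_Ioc_comp_add_left' (G : ℝ → ℝ≥0∞) (c u L : ℝ) :
    ∫⁻ v in Ioc u (u + L), G (c + v) = ∫⁻ v in Ioc (c + u) (c + u + L), G v := by
  rw [← setLIntegral_Ioc_comp_add_left (fun v => G (c + v)), ← setLIntegral_Ioc_comp_add_left]
  simp_rw [add_assoc]

/-! ### Mass of balls after multiplication by a bump -/

section Step

variable {E : Type*} [NormedAddCommGroup E] [InnerProductSpace ℝ E] [FiniteDimensional ℝ E]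
  [MeasurableSpace E] [BorelSpace E]

theorem setLIntegral_ball_inner_le {e : E} (he : ‖e‖ = 1) {G : ℝ → ℝ≥0∞} (hG : Measurable G)
    {a C : ℝ} {r : ℝ} (hr : 0 < r) (hC : 0 ≤ C)
    (h : ∀ u, ∫⁻ v in Ioc u (u + r), G v ≤ ENNReal.ofReal (C * r ^ a)) (c : E) :
    ∫⁻ x in Metric.ball c r, G (inner ℝ e x) ≤
      ENNReal.ofReal (C * 2 ^ Module.finrank ℝ E * r ^ (Module.finrank ℝ E + a - 1)) *
        volume (Metric.ball (0 : E) 1) := by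
  have h1 := ofReal_mul_lintegral_mul_inner_le he (L := r) (B := ENNReal.ofReal (C * r ^ a))
    (F := (Metric.ball c r).indicator 1) (F' := (Metric.ball c (2 * r)).indicator 1)
    (measurable_one.indicator Metric.isOpen_ball.measurableSet)
    (measurable_one.indicator Metric.isOpen_ball.measurableSet) hG h (fun x t ht => by
      by_cases hx : x + t • e ∈ Metric.ball c r
      · have hd : dist x (x + t • e) = t := by
          rw [dist_eq_norm]; simp [norm_smul, he, abs_of_pos ht.1]
        have h2 : x ∈ Metric.ball c (2 * r) := by
          have := dist_triangle x (x + t • e) c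
          rw [Metric.mem_ball] at hx ⊢
          linarith [ht.2]
        rw [indicator_of_mem hx, indicator_of_mem h2]; rfl
      · rw [indicator_of_notMem hx]; exact zero_le)
  have hr0 : ENNReal.ofReal r ≠ 0 := by simpa using hr
  rw [lintegral_indicator Metric.isOpen_ball.measurableSet, Pi.one_def, setLIntegral_const, one_mul,
    addHaar_ball_of_pos _ _ (by positivity)] at h1
  have h2 : ∫⁻ x, (Metric.ball c r).indicator (fun _ => (1 : ℝ≥0∞)) x * G (inner ℝ e x) =
      ∫⁻ x in Metric.ball c r, G (inner ℝ e x) := by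
    rw [← lintegral_indicator Metric.isOpen_ball.measurableSet]
    refine lintegral_congr fun x => ?_
    by_cases hx : x ∈ Metric.ball c r <;> simp [hx]
  rw [h2, ← mul_assoc, ← ENNReal.ofReal_mul (by positivity)] at h1
  have h3 : C * r ^ a * (2 * r) ^ Module.finrank ℝ E =
      r * (C * 2 ^ Module.finrank ℝ E * r ^ (Module.finrank ℝ E + a - 1)) := by
    rw [mul_pow, Real.rpow_sub_one hr.ne', Real.rpow_add hr, Real.rpow_natCast]
    field_simp
  rw [h3, ENNReal.ofReal_mul hr.le, mul_assoc,
    ENNReal.mul_le_mul_iff_right hr0 ENNReal.ofReal_ne_top] at h1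
  exact h1

/-- Over one period `G` has mean one while `F` varies by at most ω, so `G` may be dropped with error
ω per unit volume. Shifts by at most ρ enlarge balls by ρ and keep the error within distance 1 of
`K`. -/
theorem lintegral_mul_inner_comparison {e : E} (he : ‖e‖ = 1) {F : E → ℝ≥0} (hF : Measurable F)
    {G : ℝ → ℝ≥0∞} (hG : Measurable G) {ρ : ℝ} (hρ : 0 < ρ) (hρ1 : ρ ≤ 1)
    (hGint : ∀ u, ∫⁻ v in Ioc u (u + ρ), G v = ENNReal.ofReal ρ) {K : Set E}
    (hFK : ∀ x, F x ≠ 0 → x ∈ K) {ω : ℝ≥0}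
    (hω : ∀ x, ∀ h ∈ Ioc 0 ρ, F (x + h • e) ≤ F x + ω ∧ F x ≤ F (x + h • e) + ω) :
    (∀ c r, ∫⁻ x in Metric.ball c r, F x * G (inner ℝ e x) ≤
      (∫⁻ x in Metric.ball c (r + ρ), F x) + ω * volume (Metric.cthickening 1 K)) ∧
    ∫⁻ x, F x ≤ (∫⁻ x, F x * G (inner ℝ e x)) + ω * volume (Metric.cthickening 1 K) := by
  have hρ0 : ENNReal.ofReal ρ ≠ 0 := by simpa using hρ
  have hmK : MeasurableSet (Metric.cthickening 1 K) := Metric.isClosed_cthickening.measurableSet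
  have hFm : Measurable fun x => (F x : ℝ≥0∞) := hF.coe_nnreal_ennreal
  have hωm : Measurable ((Metric.cthickening 1 K).indicator fun _ => (ω : ℝ≥0∞)) :=
    measurable_const.indicator hmK
  constructor
  · intro c r
    have h1 := ofReal_mul_lintegral_mul_inner_le he (L := ρ) (B := ENNReal.ofReal ρ)
      (F := (Metric.ball c r).indicator fun x => (F x : ℝ≥0∞))
      (F' := fun x => (Metric.ball c (r + ρ)).indicator (fun x => (F x : ℝ≥0∞)) x +
        (Metric.cthickening 1 K).indicator (fun _ => (ω : ℝ≥0∞)) x)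
      (hFm.indicator Metric.isOpen_ball.measurableSet)
      ((hFm.indicator Metric.isOpen_ball.measurableSet).add hωm) hG (fun u => (hGint u).le)
      (fun x h hh => by
        by_cases hx : x + h • e ∈ Metric.ball c r
        · rw [indicator_of_mem hx]
          by_cases hFx : F (x + h • e) = 0
          · simp [hFx]
          have hd : dist x (x + h • e) = h := by
            rw [dist_eq_norm]; simp [norm_smul, he, abs_of_pos hh.1]
          have h2 : x ∈ Metric.ball c (r + ρ) := by
            have := dist_triangle x (x + h • e) c
            rw [Metric.mem_ball] at hx ⊢
            linarith [hh.2]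
          have h3 : x ∈ Metric.cthickening 1 K :=
            Metric.mem_cthickening_of_dist_le x _ 1 K (hFK _ hFx) (by rw [hd]; linarith [hh.2])
          rw [indicator_of_mem h2, indicator_of_mem h3]
          exact_mod_cast (hω x h hh).1
        · rw [indicator_of_notMem hx]; exact zero_le)
    rw [ENNReal.mul_le_mul_iff_right hρ0 ENNReal.ofReal_ne_top,
      lintegral_add_right _ hωm, lintegral_indicator hmK,
      lintegral_indicator Metric.isOpen_ball.measurableSet, setLIntegral_const] at h1
    refine le_trans (le_of_eq ?_) h1
    rw [← lintegral_indicator Metric.isOpen_ball.measurableSet]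
    refine lintegral_congr fun x => ?_
    by_cases hx : x ∈ Metric.ball c r <;> simp [hx]
  · have h1 := le_ofReal_mul_lintegral_mul_inner he (L := ρ) (B := ENNReal.ofReal ρ)
      (F := fun x => (F x : ℝ≥0∞))
      (F' := fun x => (F x : ℝ≥0∞) -
        (Metric.cthickening 1 K).indicator (fun _ => (ω : ℝ≥0∞)) x)
      hFm (hFm.sub hωm) hG (fun u => (hGint u).ge)
      (fun x h hh => by
        rw [tsub_le_iff_right]
        by_cases hFx : F x = 0
        · simp [hFx]
        rw [indicator_of_mem (Metric.self_subset_cthickening K (hFK x hFx))]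
        exact_mod_cast (hω x h hh).2)
    rw [ENNReal.mul_le_mul_iff_right hρ0 ENNReal.ofReal_ne_top] at h1
    calc ∫⁻ x, F x ≤ ∫⁻ x, (((F x : ℝ≥0∞) -
          (Metric.cthickening 1 K).indicator (fun _ => (ω : ℝ≥0∞)) x) +
          (Metric.cthickening 1 K).indicator (fun _ => (ω : ℝ≥0∞)) x) :=
          lintegral_mono fun x => le_tsub_add
      _ = _ := by rw [lintegral_add_right _ hωm, lintegral_indicator hmK, setLIntegral_const]
      _ ≤ _ := add_le_add_left h1 _

end Step

/-! ### Frostman densities -/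

section Density

variable {E : Type*} [NormedAddCommGroup E] [InnerProductSpace ℝ E] [FiniteDimensional ℝ E]
  [MeasurableSpace E] [BorelSpace E]

/-- A continuous density supported in `K`, of mass greater than `m`, which gives to every ball of
radius `r` less than `A` times the gauge `logGauge p r`, uniformly. -/
structure IsFrostmanDensity (K : Set E) (p A m : ℝ) (f : E → ℝ≥0) : Prop where
  continuous : Continuous f
  tsupport_subset : tsupport f ⊆ K
  lt_lintegral : ENNReal.ofReal m < ∫⁻ x, f x
  exists_ball_le : ∃ B, 0 ≤ B ∧ B < A ∧ ∀ c r, 0 < r →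
    ∫⁻ x in Metric.ball c r, f x ≤ ENNReal.ofReal (B * logGauge p r)

omit [FiniteDimensional ℝ E] [MeasurableSpace E] [BorelSpace E] in
theorem exists_forall_add_smul_le {F : E → ℝ≥0} (hF : Continuous F) (hFc : HasCompactSupport F)
    {e : E} (he : ‖e‖ = 1) {ω : ℝ≥0} (hω : 0 < ω) :
    ∃ η : ℝ, 0 < η ∧ ∀ ρ : ℝ, ρ < η → ∀ x, ∀ h ∈ Ioc 0 ρ,
      F (x + h • e) ≤ F x + ω ∧ F x ≤ F (x + h • e) + ω := by
  have hu : UniformContinuous fun x => (F x : ℝ) :=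
    (hFc.comp_left (g := ((↑) : ℝ≥0 → ℝ)) NNReal.coe_zero).uniformContinuous_of_continuous
      (NNReal.continuous_coe.comp hF)
  obtain ⟨η, hη, h⟩ := Metric.uniformContinuous_iff.1 hu ω (by exact_mod_cast hω)
  refine ⟨η, hη, fun ρ hρ x t ht => ?_⟩
  have hd : dist x (x + t • e) = t := by
    rw [dist_eq_norm]; simp [norm_smul, he, abs_of_pos ht.1]
  have h1 := h (a := x) (b := x + t • e) (by rw [hd]; linarith [ht.2])
  rw [Real.dist_eq, abs_lt] at h1
  constructor <;> rw [← NNReal.coe_le_coe] <;> push_cast <;> linarith [h1.1, h1.2]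

set_option maxHeartbeats 1000000 in
-- The strict inequalities in `IsFrostmanDensity` leave slack, and a small δ spends only part of it.
-- The bumps depend on δ, so they are quantified after it.
theorem IsFrostmanDensity.exists_forall_mul {K : Set E} (hK : IsCompact K) {p a A m : ℝ}
    (ha0 : 0 < a) (ha1 : a ≤ 1) (hp0 : 0 ≤ p) (hp : p ≤ Module.finrank ℝ E + a - 1) (hm : 0 ≤ m)
    {f : E → ℝ≥0} (hf : IsFrostmanDensity K p A m f) {e : E} (he : ‖e‖ = 1)
    {χ : E → ℝ≥0} (hχ : Continuous χ) (hχ1 : ∀ x, χ x ≤ 1) :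
    ∀ᶠ δ in 𝓝[>] (0 : ℝ), ∀ G₁ G₂ : ℝ → ℝ≥0, Continuous G₁ → Continuous G₂ →
      (∀ u, ∫⁻ v in Ioc u (u + 4 * δ ^ a), (G₁ v : ℝ≥0∞) = ENNReal.ofReal (4 * δ ^ a)) →
      (∀ u, ∫⁻ v in Ioc u (u + 4 * δ ^ a), (G₂ v : ℝ≥0∞) = ENNReal.ofReal (4 * δ ^ a)) →
      (∀ u, (G₁ u : ℝ≥0∞) ≤ ENNReal.ofReal (8 * (4 * δ ^ a) / δ)) →
      (∀ u, (G₂ u : ℝ≥0∞) ≤ ENNReal.ofReal (8 * (4 * δ ^ a) / δ)) →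
      IsFrostmanDensity K p A m
        (fun x => f x * χ x * G₁ (inner ℝ e x) + f x * (1 - χ x) * G₂ (inner ℝ e x)) := by
  obtain ⟨B, hB0, hBA, hB⟩ := hf.exists_ball_le
  have hfc : HasCompactSupport f := hK.of_isClosed_subset (isClosed_tsupport f) hf.tsupport_subset
  have hfK : ∀ x, f x ≠ 0 → x ∈ K := fun x hx => hf.tsupport_subset (subset_tsupport f hx)
  have hcont := hf.continuous
  obtain ⟨M, hM⟩ : ∃ M : ℝ≥0, ∀ x, f x ≤ M := by
    obtain ⟨M, hM⟩ := (hfc.comp_left (g := ((↑) : ℝ≥0 → ℝ))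
      NNReal.coe_zero).exists_bound_of_continuous (NNReal.continuous_coe.comp hcont)
    refine ⟨M.toNNReal, fun x => ?_⟩
    have h1 := hM x
    simp only [Function.comp_apply, NNReal.norm_eq] at h1
    exact NNReal.le_toNNReal_of_coe_le h1
  set v := (volume (Metric.ball (0 : E) 1)).toReal
  have hv : volume (Metric.ball (0 : E) 1) = ENNReal.ofReal v :=
    (ENNReal.ofReal_toReal measure_ball_lt_top.ne).symm
  set V := (volume (Metric.cthickening 1 K)).toReal
  have hV : volume (Metric.cthickening 1 K) = ENNReal.ofReal V :=
    (ENNReal.ofReal_toReal hK.cthickening.measure_lt_top.ne).symm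
  have hV0 : 0 ≤ V := ENNReal.toReal_nonneg
  have hv0 : 0 ≤ v := ENNReal.toReal_nonneg
  have hfin : ∫⁻ x, (f x : ℝ≥0∞) ≠ ∞ := by
    refine ne_top_of_le_ne_top (b := (M : ℝ≥0∞) * volume K)
      (ENNReal.mul_ne_top ENNReal.coe_ne_top hK.measure_lt_top.ne) ?_
    rw [← setLIntegral_const, ← lintegral_indicator hK.measurableSet]
    refine lintegral_mono fun x => ?_
    by_cases hx : f x = 0
    · simp [hx]
    · rw [indicator_of_mem (hfK x hx)]; exact ENNReal.coe_le_coe.2 (hM x)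
  set I := (∫⁻ x, (f x : ℝ≥0∞)).toReal
  have hI : ∫⁻ x, (f x : ℝ≥0∞) = ENNReal.ofReal I := (ENNReal.ofReal_toReal hfin).symm
  have hmI : m < I := by
    have := hf.lt_lintegral
    rw [hI] at this
    exact (ENNReal.ofReal_lt_ofReal_iff_of_nonneg hm).1 this
  set η := (A - B) / 4 with hη
  have hη0 : 0 < η := by simp only [hη]; linarith
  -- The threshold `R` depends on `f` only, through its maximum `M`; it is fixed before δ.
  obtain ⟨R, hR0, hR1, hR⟩ := exists_forall_mul_rpow_le_logGauge p
    (2 * M * (32 * 2 ^ Module.finrank ℝ E) * v) (B := B + 2 * η) (by linarith)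
  -- The total averaging error of the two pieces, 2ωV, must fit into the slack of the ball bound at
  -- radius `R` and into that of the mass.
  obtain ⟨ω, hω0, hω1, hω2⟩ : ∃ ω : ℝ, 0 < ω ∧ 2 * ω * V ≤ η * R ^ p ∧
      m + 2 * ω * V < I := by
    have hRp : 0 < R ^ p := by positivity
    set t := min (η * R ^ p) ((I - m) / 2) with ht
    have ht0 : 0 < t := lt_min (by positivity) (by linarith)
    refine ⟨t / (2 * (V + 1)), by positivity, ?_⟩
    have h1 : 2 * (t / (2 * (V + 1))) * V ≤ t := by
      rw [show 2 * (t / (2 * (V + 1))) * V = t * (V / (V + 1)) by field_simp]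
      exact mul_le_of_le_one_right ht0.le ((div_le_one (by positivity)).2 (by linarith))
    have h2 : t ≤ η * R ^ p := min_le_left _ _
    have h3 : t ≤ (I - m) / 2 := min_le_right _ _
    constructor <;> linarith
  lift ω to ℝ≥0 using hω0.le
  have hω0 : 0 < ω := by exact_mod_cast hω0
  obtain ⟨η₁, hη₁, hosc₁⟩ := exists_forall_add_smul_le (F := fun x => f x * χ x)
    (by fun_prop) hfc.mul_right he hω0
  obtain ⟨η₂, hη₂, hosc₂⟩ := exists_forall_add_smul_le (F := fun x => f x * (1 - χ x))
    (by fun_prop) hfc.mul_right he hω0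
  have ht : Tendsto (fun δ : ℝ => 4 * δ ^ a) (𝓝[>] 0) (𝓝 0) := by
    have : ContinuousAt (fun δ : ℝ => 4 * δ ^ a) 0 :=
      (Real.continuousAt_rpow_const _ _ (Or.inr ha0.le)).const_mul 4
    have h2 := this.tendsto
    simp only [Real.zero_rpow ha0.ne', mul_zero] at h2
    exact h2.mono_left nhdsWithin_le_nhds
  have htR : Tendsto (fun ρ : ℝ => B * (1 + ρ / R) ^ p) (𝓝 0) (𝓝 B) := by
    have : ContinuousAt (fun ρ : ℝ => B * (1 + ρ / R) ^ p) 0 := by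
      refine ContinuousAt.const_mul (ContinuousAt.rpow_const (by fun_prop) (Or.inl (by simp))) _
    simpa [ContinuousAt] using this
  filter_upwards [self_mem_nhdsWithin, ht.eventually_lt_const hη₁, ht.eventually_lt_const hη₂,
    ht.eventually_lt_const one_pos, ht.eventually (htR.eventually_lt_const (u := B + η)
      (by linarith))] with δ hδ hδ₁ hδ₂ hδ1 hδR
  intro G₁ G₂ hG₁ hG₂ hi₁ hi₂ hs₁ hs₂
  have hδ : 0 < δ := hδ
  set ρ := 4 * δ ^ a with hρ
  have hρ0 : 0 < ρ := by positivity
  have hm₁ : Measurable fun u => (G₁ u : ℝ≥0∞) := hG₁.measurable.coe_nnreal_ennreal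
  have hm₂ : Measurable fun u => (G₂ u : ℝ≥0∞) := hG₂.measurable.coe_nnreal_ennreal
  have hF₁ : Continuous fun x => f x * χ x := by fun_prop
  have hF₂ : Continuous fun x => f x * (1 - χ x) := by fun_prop
  have hadd : ∀ x, f x * χ x + f x * (1 - χ x) = f x := fun x => by
    rw [← mul_add, add_tsub_cancel_of_le (hχ1 x), mul_one]
  obtain ⟨hb₁, ht₁⟩ := lintegral_mul_inner_comparison he hF₁.measurable hm₁ hρ0 hδ1.le hi₁
    (fun x hx => hfK x (left_ne_zero_of_mul hx)) (hosc₁ ρ hδ₁)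
  obtain ⟨hb₂, ht₂⟩ := lintegral_mul_inner_comparison he hF₂.measurable hm₂ hρ0 hδ1.le hi₂
    (fun x hx => hfK x (left_ne_zero_of_mul hx)) (hosc₂ ρ hδ₂)
  have hωV : (ω : ℝ≥0∞) * volume (Metric.cthickening 1 K) = ENNReal.ofReal (ω * V) := by
    rw [hV, ENNReal.ofReal_mul ω.coe_nonneg, ENNReal.ofReal_coe_nnreal]
  have hsum : ∀ s : Set E, ∫⁻ x in s, (f x : ℝ≥0∞) =
      (∫⁻ x in s, ((f x * χ x : ℝ≥0) : ℝ≥0∞)) + ∫⁻ x in s, ((f x * (1 - χ x) : ℝ≥0) : ℝ≥0∞) :=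
    fun s => by
      rw [← lintegral_add_left hF₁.measurable.coe_nnreal_ennreal]
      refine lintegral_congr fun x => ?_
      rw [← ENNReal.coe_add, hadd]
  have hsum' : ∀ s : Set E, ∫⁻ x in s,
      ((f x * χ x * G₁ (inner ℝ e x) + f x * (1 - χ x) * G₂ (inner ℝ e x) : ℝ≥0) : ℝ≥0∞) =
      (∫⁻ x in s, ((f x * χ x : ℝ≥0) : ℝ≥0∞) * G₁ (inner ℝ e x)) +
        ∫⁻ x in s, ((f x * (1 - χ x) : ℝ≥0) : ℝ≥0∞) * G₂ (inner ℝ e x) :=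
    fun s => by
      have hmeas : Measurable fun x => ((f x * χ x : ℝ≥0) : ℝ≥0∞) * G₁ (inner ℝ e x) :=
        hF₁.measurable.coe_nnreal_ennreal.mul (hm₁.comp (by fun_prop))
      rw [← lintegral_add_left hmeas]
      refine lintegral_congr fun x => ?_
      push_cast; rfl
  -- Of the new constant `B + 2 * η`, one η pays for enlarging balls by ρ, the other for the
  -- averaging error.
  refine ⟨by fun_prop, (closure_mono fun x hx => ?_).trans hf.tsupport_subset, ?_,
    B + 2 * η, by linarith, by simp only [hη]; linarith, fun c r hr => ?_⟩
  · intro h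
    rw [Function.mem_support] at hx
    exact hx (by simp [h])
  · have h1 := hsum univ
    have h2 := hsum' univ
    simp only [Measure.restrict_univ] at h1 h2
    by_contra! hle
    rw [h2] at hle
    have h3 : ENNReal.ofReal I ≤ ENNReal.ofReal (m + 2 * ω * V) := by
      rw [← hI, h1]
      refine (add_le_add ht₁ ht₂).trans ?_
      rw [hωV, add_add_add_comm, ← ENNReal.ofReal_add (by positivity) (by positivity)]
      refine (add_le_add_left hle _).trans ?_
      rw [← ENNReal.ofReal_add (by positivity) (by positivity)]
      exact ENNReal.ofReal_le_ofReal (by linarith)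
    rw [ENNReal.ofReal_le_ofReal_iff (by positivity)] at h3
    linarith
  · rcases le_total r R with hrR | hrR
    · have hb : ∀ G : ℝ → ℝ≥0, Measurable (fun u => (G u : ℝ≥0∞)) →
          (∀ u, ∫⁻ v in Ioc u (u + ρ), (G v : ℝ≥0∞) = ENNReal.ofReal ρ) →
          (∀ u, (G u : ℝ≥0∞) ≤ ENNReal.ofReal (8 * ρ / δ)) →
          ∫⁻ x in Metric.ball c r, (M : ℝ≥0∞) * G (inner ℝ e x) ≤
            ENNReal.ofReal (M * (32 * 2 ^ Module.finrank ℝ E) * v * r ^ p) := by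
        intro G hG hGi hGs
        have h1 := setLIntegral_ball_inner_le he hG hr (by norm_num)
          (fun u => setLIntegral_Ioc_le_rpow ha0 ha1 hδ hGi hGs hr (hrR.trans hR1) u) c
        rw [lintegral_const_mul' _ _ ENNReal.coe_ne_top]
        refine (mul_le_mul_right h1 _).trans ?_
        rw [hv, ← ENNReal.ofReal_coe_nnreal, ← ENNReal.ofReal_mul (by positivity),
          ← ENNReal.ofReal_mul (by positivity)]
        refine ENNReal.ofReal_le_ofReal ?_
        have : r ^ (Module.finrank ℝ E + a - 1) ≤ r ^ p :=
          Real.rpow_le_rpow_of_exponent_ge hr (hrR.trans hR1) hp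
        calc (M : ℝ) * (32 * 2 ^ Module.finrank ℝ E * r ^ (Module.finrank ℝ E + a - 1) * v)
            ≤ M * (32 * 2 ^ Module.finrank ℝ E * r ^ p * v) := by gcongr
          _ = _ := by ring
      rw [hsum']
      calc _ ≤ (∫⁻ x in Metric.ball c r, (M : ℝ≥0∞) * G₁ (inner ℝ e x)) +
            ∫⁻ x in Metric.ball c r, (M : ℝ≥0∞) * G₂ (inner ℝ e x) := by
            have h1 : ∀ x, f x * χ x ≤ M := fun x =>
              (le_self_add.trans (hadd x).le).trans (hM x)
            have h2 : ∀ x, f x * (1 - χ x) ≤ M := fun x =>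
              (le_add_self.trans (hadd x).le).trans (hM x)
            refine add_le_add (lintegral_mono fun x => ?_) (lintegral_mono fun x => ?_)
            · exact mul_le_mul_left (ENNReal.coe_le_coe.2 (h1 x)) _
            · exact mul_le_mul_left (ENNReal.coe_le_coe.2 (h2 x)) _
        _ ≤ _ := add_le_add (hb G₁ hm₁ hi₁ hs₁) (hb G₂ hm₂ hi₂ hs₂)
        _ ≤ _ := by
          rw [← ENNReal.ofReal_add (by positivity) (by positivity)]
          refine ENNReal.ofReal_le_ofReal (le_trans (le_of_eq ?_) (hR r hr hrR))
          ring
    · rw [hsum']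
      refine (add_le_add (hb₁ c r) (hb₂ c r)).trans ?_
      rw [add_add_add_comm, ← hsum, hωV, ← ENNReal.ofReal_add (by positivity) (by positivity)]
      refine (add_le_add_left (hB c (r + ρ) (by positivity)) _).trans ?_
      have hg0 : 0 ≤ logGauge p r := (by positivity : 0 ≤ r ^ p).trans (rpow_le_logGauge hr)
      have hg1 : 0 ≤ logGauge p (r + ρ) :=
        (by positivity : 0 ≤ (r + ρ) ^ p).trans (rpow_le_logGauge (by positivity))
      rw [← ENNReal.ofReal_add (by positivity) (by positivity)]
      refine ENNReal.ofReal_le_ofReal ?_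
      have h1 : B * logGauge p (r + ρ) ≤ (B + η) * logGauge p r := by
        calc B * logGauge p (r + ρ) ≤ B * ((1 + ρ / r) ^ p * logGauge p r) := by
              gcongr; exact logGauge_add_le hr hρ0.le
          _ ≤ B * ((1 + ρ / R) ^ p * logGauge p r) := by gcongr
          _ = B * (1 + ρ / R) ^ p * logGauge p r := by ring
          _ ≤ _ := by gcongr
      have h2 : 2 * ω * V ≤ η * logGauge p r := by
        refine hω1.trans ?_
        gcongr
        exact (Real.rpow_le_rpow hR0.le hrR hp0).trans (rpow_le_logGauge hr)
      linarith

end Density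

/-! ### Refinement by slabs -/

theorem exists_int_abs_sub_le_of_norm_le {ρ u δ : ℝ} (h : ‖(u : AddCircle ρ)‖ ≤ δ) :
    ∃ m : ℤ, |u - m * ρ| ≤ δ := by
  rw [AddCircle.norm_eq] at h
  exact ⟨_, h⟩

theorem norm_half_period_add_gt {ρ u δ : ℝ} (hδ : 0 < δ) (hρ : 4 * δ ≤ ρ)
    (h : ‖(u : AddCircle ρ)‖ ≤ δ / 2) : δ / 2 < ‖((ρ / 2 + u : ℝ) : AddCircle ρ)‖ := by
  by_contra! h'
  have h1 : ‖((ρ / 2 : ℝ) : AddCircle ρ)‖ ≤ δ := by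
    have : ((ρ / 2 : ℝ) : AddCircle ρ) = ((ρ / 2 + u : ℝ) : AddCircle ρ) - (u : AddCircle ρ) := by
      rw [← AddCircle.coe_sub]; congr 1; ring
    rw [this]
    exact (norm_sub_le _ _).trans (by linarith)
  rw [AddCircle.norm_half_period_eq, abs_of_pos (by linarith)] at h1
  linarith

section Refinement

variable {E : Type*} [NormedAddCommGroup E] [InnerProductSpace ℝ E] [FiniteDimensional ℝ E]
  [MeasurableSpace E] [BorelSpace E]

/-- Where φ > 1 only the first family of slabs is used, where φ < 0 only the one shifted by half a
period. Half a period is 2δ^a ≥ 2δ, so slabs of half-width δ/2 do not meet; all of them are centred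
at multiples of 2δ^a. -/
theorem IsFrostmanDensity.exists_refinement {K : Set E} (hK : IsCompact K) {p a A m : ℝ}
    (ha0 : 0 < a) (ha1 : a ≤ 1) (hp0 : 0 ≤ p) (hp : p ≤ Module.finrank ℝ E + a - 1) (hm : 0 ≤ m)
    {f : E → ℝ≥0} (hf : IsFrostmanDensity K p A m f) {e : E} (he : ‖e‖ = 1)
    {φ : E → ℝ} (hφ : Continuous φ) {ε : ℝ} (hε : 0 < ε) :
    ∃ (δ : ℝ) (f' : E → ℝ≥0), 0 < δ ∧ δ ≤ ε ∧ IsFrostmanDensity K p A m f' ∧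
      tsupport f' ⊆ tsupport f ∧
      (∀ x ∈ tsupport f', ∃ k : ℤ, |inner ℝ e x - k * (2 * δ ^ a)| ≤ δ) ∧
      ∀ x ∈ tsupport f', ∀ y ∈ tsupport f', 1 < φ x → φ y < 0 → inner ℝ e x ≠ inner ℝ e y := by
  let χ : E → ℝ≥0 := fun x => min (φ x).toNNReal 1
  have hχ : Continuous χ := by fun_prop
  have hev : ∀ η : ℝ, 0 < η → ∀ᶠ δ in 𝓝[>] (0 : ℝ), δ ≤ η := fun η hη =>
    nhdsWithin_le_nhds (Iic_mem_nhds hη)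
  obtain ⟨δ, hd, hδε, hδ1, hδ⟩ := ((hf.exists_forall_mul hK ha0 ha1 hp0 hp hm he hχ
    (fun x => min_le_right _ _)).and ((hev ε hε).and
    ((hev 1 one_pos).and self_mem_nhdsWithin))).exists
  have hδ : 0 < δ := hδ
  have hδ1 : δ ≤ 1 := hδ1
  set ρ := 4 * δ ^ a with hρ
  have hδρ : 4 * δ ≤ ρ := by
    have := Real.rpow_le_rpow_of_exponent_ge hδ hδ1 ha1
    rw [Real.rpow_one] at this
    linarith
  obtain ⟨G, hGc, hGi, hGs, hGsupp⟩ := exists_periodic_bump (δ := δ / 2) (ρ := ρ) (by positivity)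
    (by linarith)
  have hs : ∀ u, (G u : ℝ≥0∞) ≤ ENNReal.ofReal (8 * ρ / δ) := fun u => by
    refine (hGs u).trans (le_of_eq ?_)
    congr 1; field_simp; ring
  have hf' := hd G (fun u => G (ρ / 2 + u)) hGc (by fun_prop) hGi
    (fun u => by
      rw [setLIntegral_Ioc_comp_add_left' (fun v => (G v : ℝ≥0∞))]; exact hGi _) hs (fun u => hs _)
  set f' := fun x => f x * χ x * G (inner ℝ e x) + f x * (1 - χ x) * G (ρ / 2 + inner ℝ e x)
    with hf'def
  -- The weak inequalities make the right side closed, so the description passes from the support to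
  -- its closure.
  have hsub : tsupport f' ⊆ {x | (0 ≤ φ x ∧ ‖((inner ℝ e x : ℝ) : AddCircle ρ)‖ ≤ δ / 2) ∨
      (φ x ≤ 1 ∧ ‖((ρ / 2 + inner ℝ e x : ℝ) : AddCircle ρ)‖ ≤ δ / 2)} := by
    refine closure_minimal (fun x hx => ?_) ?_
    · rw [Function.mem_support] at hx
      by_cases h1 : f x * χ x * G (inner ℝ e x) = 0
      · have h2 : f x * (1 - χ x) * G (ρ / 2 + inner ℝ e x) ≠ 0 := fun h2 => hx (by
          simp only [hf'def, h1, h2, add_zero])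
        refine Or.inr ⟨?_, hGsupp _ (right_ne_zero_of_mul h2)⟩
        have h3 := right_ne_zero_of_mul (left_ne_zero_of_mul h2)
        by_contra! h4
        refine h3 (tsub_eq_zero_of_le (le_min ?_ le_rfl))
        rw [Real.one_le_toNNReal]; exact h4.le
      · refine Or.inl ⟨?_, hGsupp _ (right_ne_zero_of_mul h1)⟩
        have h3 := right_ne_zero_of_mul (left_ne_zero_of_mul h1)
        by_contra! h4
        refine h3 ?_
        simp only [χ]
        rw [Real.toNNReal_of_nonpos h4.le, min_eq_left (zero_le)]
    · have hq : Continuous fun u : ℝ => (u : AddCircle ρ) := AddCircle.continuous_mk' ρ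
      refine IsClosed.union ?_ ?_
      · exact (isClosed_le continuous_const hφ).inter
          (isClosed_le (hq.comp (by fun_prop : Continuous fun x : E => inner ℝ e x)).norm
            continuous_const)
      · exact (isClosed_le hφ continuous_const).inter
          (isClosed_le (hq.comp (by fun_prop : Continuous fun x : E => ρ / 2 + inner ℝ e x)).norm
            continuous_const)
  refine ⟨δ, f', hδ, hδε, hf', closure_mono fun x hx h => ?_, fun x hx => ?_,
    fun x hx y hy hφx hφy heq => ?_⟩
  · exact hx (by simp only [hf'def, h, zero_mul, add_zero])
  · rcases hsub hx with ⟨-, h⟩ | ⟨-, h⟩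
    · obtain ⟨k, hk⟩ := exists_int_abs_sub_le_of_norm_le h
      refine ⟨2 * k, ?_⟩
      rw [show ((2 * k : ℤ) : ℝ) * (2 * δ ^ a) = k * ρ by rw [hρ]; push_cast; ring]
      linarith
    · obtain ⟨k, hk⟩ := exists_int_abs_sub_le_of_norm_le h
      refine ⟨2 * k - 1, ?_⟩
      rw [show inner ℝ e x - ((2 * k - 1 : ℤ) : ℝ) * (2 * δ ^ a) =
        ρ / 2 + inner ℝ e x - k * ρ by rw [hρ]; push_cast; ring]
      linarith
  · rcases hsub hx with ⟨-, h⟩ | ⟨h, -⟩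
    · rcases hsub hy with ⟨h', -⟩ | ⟨-, h'⟩
      · linarith
      · rw [heq] at h
        exact absurd h' (not_le.2 (norm_half_period_add_gt hδ hδρ h))
    · linarith

end Refinement

/-! ### Dimension bounds in the limit -/

/-- No limit measure is needed. If the intersection were null in some dimension q < p, an economical
open cover of it would, by compactness, contain the support of some `f k`, and the ball bounds would
give that density mass at most `m`. -/
theorem le_dimH_of_frostman {E : Type*} [NormedAddCommGroup E] [InnerProductSpace ℝ E]
    [FiniteDimensional ℝ E] [MeasurableSpace E] [BorelSpace E] {K : Set E} (hK : IsCompact K)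
    {p A m : ℝ} (hm : 0 < m) {f : ℕ → E → ℝ≥0}
    (hf : ∀ k, IsFrostmanDensity K p A m (f k))
    (hmono : ∀ k, tsupport (f (k + 1)) ⊆ tsupport (f k)) :
    ENNReal.ofReal p ≤ dimH (⋂ k, tsupport (f k)) := by
  refine le_of_forall_lt_imp_le_of_dense fun b hb => ?_
  obtain ⟨q, hbq, hqp⟩ := ENNReal.lt_iff_exists_nnreal_btwn.1 hb
  refine hbq.le.trans (le_dimH_of_hausdorffMeasure_ne_zero fun h0 => ?_)
  have hq0 : (0 : ℝ) < q := by
    have : (0 : ℝ≥0∞) < q := lt_of_le_of_lt (zero_le) hbq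
    exact_mod_cast this
  have hqp' : (q : ℝ) < p := by
    rw [← ENNReal.ofReal_coe_nnreal] at hqp
    exact (ENNReal.ofReal_lt_ofReal_iff_of_nonneg q.coe_nonneg).1 hqp
  obtain ⟨C, hC0, hC⟩ := logGauge_le_rpow hqp'
  have hA : 0 < A := by
    obtain ⟨B, hB0, hBA, -⟩ := (hf 0).exists_ball_le
    linarith
  -- The bound 1/2 keeps the radii 2δ at most 1, where the gauge is compared with r^q; the other
  -- term makes the total at most `m`.
  set ε : ℝ := min (1 / 2) (m / (A * C * 2 ^ (q : ℝ) + 1)) with hε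
  have hε0 : 0 < ε := by positivity
  have hεm : A * C * 2 ^ (q : ℝ) * ε ≤ m := by
    calc A * C * 2 ^ (q : ℝ) * ε
        ≤ (A * C * 2 ^ (q : ℝ) + 1) * (m / (A * C * 2 ^ (q : ℝ) + 1)) :=
          mul_le_mul (by linarith) (min_le_right _ _) hε0.le (by positivity)
      _ = m := by field_simp
  obtain ⟨t, δ, hδ, hdiam, hcov, hsum⟩ := exists_cover_of_hausdorffMeasure_eq_zero hq0 h0 hε0
  have hball : ∀ n, ∃ c, t n ⊆ Metric.ball c (2 * δ n) := fun n => by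
    rcases (t n).eq_empty_or_nonempty with h | ⟨c, hc⟩
    · exact ⟨0, by simp [h]⟩
    · refine ⟨c, fun x hx => ?_⟩
      have h1 := (Metric.edist_le_ediam_of_mem hx hc).trans (hdiam n)
      rw [edist_dist, ENNReal.ofReal_le_ofReal_iff (hδ n).1.le] at h1
      rw [Metric.mem_ball]
      linarith [(hδ n).1]
  choose c hc using hball
  set U := ⋃ n, Metric.ball (c n) (2 * δ n) with hU
  have hUo : IsOpen U := isOpen_iUnion fun n => Metric.isOpen_ball
  have hanti : Antitone fun k => tsupport (f k) := antitone_nat_of_succ_le hmono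
  obtain ⟨k, hk⟩ : ∃ k, tsupport (f k) ⊆ U :=
    exists_subset_nhds_of_isCompact' hanti.directed_ge
      (fun k => hK.of_isClosed_subset (isClosed_tsupport _) (hf k).tsupport_subset)
      (fun k => isClosed_tsupport _)
      (fun x hx => hUo.mem_nhds (iUnion_mono hc (hcov hx)))
  obtain ⟨B, hB0, hBA, hB⟩ := (hf k).exists_ball_le
  refine absurd (hf k).lt_lintegral (not_lt.2 ?_)
  calc ∫⁻ x, (f k x : ℝ≥0∞) ≤ ∫⁻ x in U, (f k x : ℝ≥0∞) := by
        rw [← lintegral_indicator hUo.measurableSet]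
        refine lintegral_mono fun x => ?_
        by_cases hx : f k x = 0
        · simp [hx]
        · rw [indicator_of_mem (hk (subset_tsupport _ hx))]
    _ ≤ ∑' n, ∫⁻ x in Metric.ball (c n) (2 * δ n), (f k x : ℝ≥0∞) := lintegral_iUnion_le _ _
    _ ≤ ∑' n, ENNReal.ofReal (A * C * 2 ^ (q : ℝ)) * ENNReal.ofReal (δ n ^ (q : ℝ)) := by
        refine ENNReal.tsum_le_tsum fun n => ?_
        have hδn := (hδ n).1
        refine (hB (c n) (2 * δ n) (by positivity)).trans ?_
        rw [← ENNReal.ofReal_mul (by positivity)]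
        refine ENNReal.ofReal_le_ofReal ?_
        have h1 := hC (2 * δ n) (by positivity)
          (by linarith [(hδ n).2, (min_le_left _ _ : ε ≤ 1 / 2)])
        have h2 : 0 ≤ logGauge p (2 * δ n) :=
          (by positivity : 0 ≤ (2 * δ n) ^ p).trans (rpow_le_logGauge (by positivity))
        calc B * logGauge p (2 * δ n) ≤ A * (C * (2 * δ n) ^ (q : ℝ)) := by gcongr
          _ = _ := by rw [Real.mul_rpow (by norm_num) hδn.le]; ring
    _ = ENNReal.ofReal (A * C * 2 ^ (q : ℝ)) * ∑' n, ENNReal.ofReal (δ n ^ (q : ℝ)) :=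
        ENNReal.tsum_mul_left
    _ ≤ ENNReal.ofReal (A * C * 2 ^ (q : ℝ)) * ENNReal.ofReal ε := by gcongr
    _ ≤ ENNReal.ofReal m := by
        rw [← ENNReal.ofReal_mul (by positivity)]
        exact ENNReal.ofReal_le_ofReal hεm

/-- A bounded set needs O(δ^(-α)) intervals of length 2δ, so the sum is O(δ^(t-α)). -/
theorem hausdorffMeasure_eq_zero_of_forall_exists_int {S : Set ℝ} (hS : Bornology.IsBounded S)
    {a t : ℝ} (hat : a < t) (ht0 : 0 < t) {δ α : ℕ → ℝ} (hδ0 : ∀ j, 0 < δ j)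
    (hδ : Tendsto δ atTop (𝓝 0)) (hα0 : ∀ j, 0 ≤ α j) (hα : Tendsto α atTop (𝓝 a))
    (h : ∀ j, ∀ u ∈ S, ∃ k : ℤ, |u - k * (2 * δ j ^ α j)| ≤ δ j) :
    μH[t] S = 0 := by
  obtain ⟨R, hR0, hR⟩ : ∃ R : ℝ, 0 < R ∧ ∀ u ∈ S, |u| ≤ R := hS.exists_pos_norm_le
  let M : ℕ → ℕ := fun j => ⌈(R + 1) / (2 * δ j ^ α j)⌉₊
  have hδ1 : ∀ᶠ j in atTop, δ j ≤ 1 := hδ.eventually_le_const one_pos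
  -- Stopping halfway between a and t leaves the positive exponent (t - a)/2.
  have hα1 : ∀ᶠ j in atTop, α j ≤ a + (t - a) / 2 := hα.eventually_le_const (by linarith)
  have hdiam : ∀ j (k : ℤ), Metric.ediam (Metric.closedBall (k * (2 * δ j ^ α j)) (δ j)) ≤
      ENNReal.ofReal (2 * δ j) := fun j k => by
    rw [Real.closedBall_eq_Icc, Real.ediam_Icc]
    exact ENNReal.ofReal_le_ofReal (by linarith)
  have hb := hausdorffMeasure_le_liminf_sum t S (l := atTop)
    (ι := fun j => Finset.Icc (-(M j : ℤ)) (M j))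
    (fun j : ℕ => ENNReal.ofReal (2 * δ j)) (by
      rw [← ENNReal.ofReal_zero]
      refine ENNReal.tendsto_ofReal ?_
      simpa using hδ.const_mul 2)
    (fun j k => Metric.closedBall (((k : ℤ) : ℝ) * (2 * δ j ^ α j)) (δ j))
    (Eventually.of_forall fun j k => hdiam j k)
    (hδ1.mono fun j hj u hu => by
      obtain ⟨k, hk⟩ := h j u hu
      have hw : 0 < 2 * δ j ^ α j := by have := hδ0 j; positivity
      have h1 : |(k : ℝ)| * (2 * δ j ^ α j) ≤ R + 1 := by
        rw [← abs_of_pos hw, ← abs_mul]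
        have h2 := abs_sub_abs_le_abs_sub ((k : ℝ) * (2 * δ j ^ α j)) u
        rw [abs_sub_comm] at h2
        linarith [hR u hu]
      rw [← le_div_iff₀ hw] at h1
      have h3 : |(k : ℝ)| ≤ M j := h1.trans (Nat.le_ceil _)
      have h4 : |k| ≤ M j := by exact_mod_cast h3
      rw [abs_le] at h4
      refine mem_iUnion.2 ⟨⟨k, Finset.mem_Icc.2 h4⟩, ?_⟩
      rw [Metric.mem_closedBall, Real.dist_eq]
      exact hk)
  have hlim : Tendsto (fun j => ENNReal.ofReal ((R + 4) * 2 ^ t * δ j ^ ((t - a) / 2))) atTop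
      (𝓝 0) := by
    rw [← ENNReal.ofReal_zero]
    refine ENNReal.tendsto_ofReal ?_
    have h1 := (hδ.rpow_const (p := (t - a) / 2) (Or.inr (by linarith))).const_mul
      ((R + 4) * 2 ^ t)
    rwa [Real.zero_rpow (by linarith), mul_zero] at h1
  refine le_antisymm (hb.trans ?_) (zero_le)
  rw [← hlim.liminf_eq]
  refine liminf_le_liminf ?_
  filter_upwards [hδ1, hα1] with j hj1 hj2
  have hδj := hδ0 j
  calc _ ≤ ∑ k : Finset.Icc (-(M j : ℤ)) (M j), ENNReal.ofReal ((2 * δ j) ^ t) := by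
        refine Finset.sum_le_sum fun k _ => ?_
        rw [← ENNReal.ofReal_rpow_of_pos (by positivity)]
        exact ENNReal.rpow_le_rpow (hdiam j k) ht0.le
    _ = ENNReal.ofReal ((2 * M j + 1) * (2 * δ j) ^ t) := by
        rw [Finset.sum_const, Finset.card_univ, Fintype.card_coe, Int.card_Icc, nsmul_eq_mul,
          ENNReal.ofReal_mul (by positivity)]
        congr 1
        rw [show ((M j : ℤ) + 1 - -(M j : ℤ)).toNat = 2 * M j + 1 by omega,
          ← ENNReal.ofReal_natCast]
        push_cast; rfl
    _ ≤ _ := by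
        refine ENNReal.ofReal_le_ofReal ?_
        have hp : 0 < δ j ^ α j := by positivity
        have hp1 : δ j ^ α j ≤ 1 := Real.rpow_le_one hδj.le hj1 (hα0 j)
        have h1 : (2 * M j + 1 : ℝ) * δ j ^ α j ≤ R + 4 := by
          have h2 := Nat.ceil_lt_add_one (a := (R + 1) / (2 * δ j ^ α j)) (by positivity)
          calc (2 * M j + 1 : ℝ) * δ j ^ α j
              ≤ (2 * ((R + 1) / (2 * δ j ^ α j) + 1) + 1) * δ j ^ α j := by gcongr
            _ = R + 1 + 3 * δ j ^ α j := by field_simp; ring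
            _ ≤ _ := by linarith
        have h3 : δ j ^ t ≤ δ j ^ α j * δ j ^ ((t - a) / 2) := by
          rw [← Real.rpow_add hδj]
          exact Real.rpow_le_rpow_of_exponent_ge hδj hj1 (by linarith)
        calc (2 * M j + 1 : ℝ) * (2 * δ j) ^ t = (2 * M j + 1) * (2 ^ t * δ j ^ t) := by
              rw [Real.mul_rpow (by norm_num) hδj.le]
          _ ≤ (2 * M j + 1) * (2 ^ t * (δ j ^ α j * δ j ^ ((t - a) / 2))) := by gcongr
          _ = ((2 * M j + 1) * δ j ^ α j) * (2 ^ t * δ j ^ ((t - a) / 2)) := by ring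
          _ ≤ (R + 4) * (2 ^ t * δ j ^ ((t - a) / 2)) := by gcongr
          _ = _ := by ring

theorem dimH_le_of_forall_exists_int {S : Set ℝ} (hS : Bornology.IsBounded S)
    {a : ℝ} (ha : 0 ≤ a) {δ α : ℕ → ℝ} (hδ0 : ∀ j, 0 < δ j)
    (hδ : Tendsto δ atTop (𝓝 0)) (hα0 : ∀ j, 0 ≤ α j) (hα : Tendsto α atTop (𝓝 a))
    (h : ∀ j, ∀ u ∈ S, ∃ k : ℤ, |u - k * (2 * δ j ^ α j)| ≤ δ j) :
    dimH S ≤ ENNReal.ofReal a := by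
  refine ENNReal.le_of_forall_pos_le_add fun ε hε _ => ?_
  lift a to ℝ≥0 using ha
  have h0 : μH[((a + ε : ℝ≥0) : ℝ)] S = 0 := by
    have hε' : (0 : ℝ) < ε := hε
    refine hausdorffMeasure_eq_zero_of_forall_exists_int hS (a := a) ?_ ?_ hδ0 hδ hα0 hα h
    · push_cast; linarith
    · push_cast; positivity
  have := dimH_le_of_hausdorffMeasure_ne_top (d := a + ε) (s := S) (by rw [h0]; simp)
  simpa using this

/-! ### Construction of Γ and its projections -/

section Construction

variable {E : Type*} [NormedAddCommGroup E] [InnerProductSpace ℝ E] [FiniteDimensional ℝ E]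

theorem exists_isFrostmanDensity [MeasurableSpace E] [BorelSpace E] {K : Set E}
    (hK : (interior K).Nonempty) {p : ℝ} (hp0 : 0 ≤ p) (hp : p ≤ Module.finrank ℝ E) :
    ∃ (A m : ℝ) (f : E → ℝ≥0), 0 < m ∧ IsFrostmanDensity K p A m f := by
  obtain ⟨x₀, hx₀⟩ := hK
  obtain ⟨R, hR, hRK⟩ := Metric.nhds_basis_closedBall.mem_iff.1 (mem_interior_iff_mem_nhds.1 hx₀)
  let f : E → ℝ≥0 := fun x => min 1 (R - dist x x₀).toNNReal
  have hf : Continuous f := by fun_prop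
  have hfs : Function.support f = Metric.ball x₀ R := by
    ext x
    simp only [f, Function.mem_support, Metric.mem_ball, ne_eq]
    rw [← ne_eq, ← pos_iff_ne_zero, lt_min_iff, Real.toNNReal_pos, sub_pos]
    simp
  have hsupp : tsupport f ⊆ Metric.closedBall x₀ R := by
    rw [tsupport, hfs]; exact Metric.closure_ball_subset_closedBall
  have hpos : 0 < ∫⁻ x, (f x : ℝ≥0∞) := by
    rw [lintegral_pos_iff_support hf.measurable.coe_nnreal_ennreal]
    have : Function.support (fun x => (f x : ℝ≥0∞)) = Metric.ball x₀ R := by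
      rw [← hfs]; ext x; simp
    rw [this]
    exact Metric.measure_ball_pos _ _ hR
  have hle : ∀ x, (f x : ℝ≥0∞) ≤ 1 := fun x => ENNReal.coe_le_one_iff.2 (min_le_left _ _)
  obtain ⟨m, hm0, hm⟩ := ENNReal.lt_iff_exists_nnreal_btwn.1 hpos
  have hfin : ∫⁻ x, (f x : ℝ≥0∞) ≠ ∞ := by
    refine ne_top_of_le_ne_top (measure_ball_lt_top (μ := volume) (x := x₀) (r := R)).ne ?_
    rw [← setLIntegral_one, ← lintegral_indicator Metric.isOpen_ball.measurableSet, ← hfs]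
    refine lintegral_mono fun x => ?_
    by_cases hx : f x = 0
    · simp [hx]
    · rw [indicator_of_mem hx]; exact hle x
  set v := (volume (Metric.ball (0 : E) 1)).toReal
  have hv : volume (Metric.ball (0 : E) 1) = ENNReal.ofReal v :=
    (ENNReal.ofReal_toReal measure_ball_lt_top.ne).symm
  set I := (∫⁻ x, (f x : ℝ≥0∞)).toReal
  have hI : ∫⁻ x, (f x : ℝ≥0∞) = ENNReal.ofReal I := (ENNReal.ofReal_toReal hfin).symm
  have hv0 : 0 ≤ v := ENNReal.toReal_nonneg
  have hI0 : 0 ≤ I := ENNReal.toReal_nonneg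
  refine ⟨v + I + 1, m, f, by exact_mod_cast hm0, hf, hsupp.trans hRK, ?_, v + I, by positivity,
    by linarith, fun c r hr => ?_⟩
  · rwa [ENNReal.ofReal_coe_nnreal]
  · have hg := rpow_le_logGauge (p := p) hr
    have hrp : 0 < r ^ p := by positivity
    rcases le_total r 1 with h1 | h1
    · calc ∫⁻ x in Metric.ball c r, (f x : ℝ≥0∞) ≤ ∫⁻ x in Metric.ball c r, 1 :=
            lintegral_mono hle
        _ = ENNReal.ofReal (r ^ Module.finrank ℝ E * v) := by
            rw [setLIntegral_one, addHaar_ball_of_pos _ _ hr, hv, ENNReal.ofReal_mul (by positivity)]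
        _ ≤ _ := by
            refine ENNReal.ofReal_le_ofReal ?_
            have h2 : r ^ Module.finrank ℝ E ≤ r ^ p := by
              rw [← Real.rpow_natCast]
              exact Real.rpow_le_rpow_of_exponent_ge hr h1 hp
            nlinarith
    · calc ∫⁻ x in Metric.ball c r, (f x : ℝ≥0∞) ≤ ∫⁻ x, (f x : ℝ≥0∞) :=
            setLIntegral_le_lintegral _ _
        _ = ENNReal.ofReal I := hI
        _ ≤ _ := by
            refine ENNReal.ofReal_le_ofReal ?_
            have h2 : 1 ≤ r ^ p := Real.one_le_rpow h1 hp0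
            nlinarith

theorem exists_isCompact_injOn_inner {K : Set E} (hK : IsCompact K) (hKi : (interior K).Nonempty)
    (hn : 1 ≤ Module.finrank ℝ E) {s : ℝ} (hs : s ∈ Icc (0 : ℝ) 1) {e : ℕ → E}
    (he : ∀ n, ‖e n‖ = 1) :
    ∃ Γ ⊆ K, IsCompact Γ ∧ ENNReal.ofReal (Module.finrank ℝ E - s) ≤ dimH Γ ∧
      ∀ n, InjOn (fun x => inner ℝ (e n) x) Γ ∧
        dimH ((fun x => inner ℝ (e n) x) '' Γ) ≤ ENNReal.ofReal (1 - s) := by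
  borelize E
  have hn' : (1 : ℝ) ≤ Module.finrank ℝ E := by exact_mod_cast hn
  have hs0 := hs.1
  have hs1 := hs.2
  set p : ℝ := Module.finrank ℝ E - s with hp
  have hp0 : 0 ≤ p := by linarith
  obtain ⟨A, m, f₀, hm, hf₀⟩ := exists_isFrostmanDensity hKi hp0 (by linarith)
  -- A refinement needs a positive exponent, while 1 - s vanishes at s = 1; hence the floor `1 / (k
  -- + 1)`, which disappears in the limit.
  let α : ℕ → ℝ := fun k => max (1 - s) (1 / (k + 1))
  have hα0 : ∀ k, 0 < α k := fun k => lt_max_of_lt_right (by positivity)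
  have hα1 : ∀ k, α k ≤ 1 := fun k => max_le (by linarith) (by
    rw [div_le_one (by positivity)]; linarith [(Nat.cast_nonneg k : (0 : ℝ) ≤ k)])
  have hαp : ∀ k, p ≤ Module.finrank ℝ E + α k - 1 := fun k => by
    have : 1 - s ≤ α k := le_max_left _ _
    linarith
  let u : ℕ → E := TopologicalSpace.denseSeq E
  -- Cones of integer steepness N at the points of a dense sequence: above 1 within distance 1/N of
  -- the apex, negative beyond 2/N. Taking N > 3 / dist x y separates x from y.
  let φ : ℕ → E → ℝ := fun j z => 2 - (Nat.unpair j).2 * dist z (u (Nat.unpair j).1)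
  have hφ : ∀ j, Continuous (φ j) := fun j => by fun_prop
  have hφsep : ∀ x y, x ≠ y → ∃ j, 1 < φ j x ∧ φ j y < 0 := fun x y hxy => by
    obtain ⟨N, hN⟩ := exists_nat_gt (3 / dist x y)
    have hD := dist_pos.2 hxy
    have hN0 : (0 : ℝ) < N := lt_trans (by positivity) hN
    obtain ⟨i, hi⟩ := (TopologicalSpace.denseRange_denseSeq E).exists_dist_lt x
      (ε := 1 / (N : ℝ)) (by positivity)
    refine ⟨Nat.pair i N, ?_⟩
    rw [div_lt_iff₀ hD] at hN
    rw [lt_div_iff₀ hN0] at hi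
    simp only [φ, u, Nat.unpair_pair]
    have htri := dist_triangle_right x y (TopologicalSpace.denseSeq E i)
    constructor <;> nlinarith
  -- Step `Nat.pair n j` treats direction n with test function j, so every pair occurs and each
  -- direction recurs at arbitrarily fine scales.
  have hstep : ∀ (k : ℕ) (f : {f : E → ℝ≥0 // IsFrostmanDensity K p A m f}),
      ∃ (δ : ℝ) (f' : {f : E → ℝ≥0 // IsFrostmanDensity K p A m f}), 0 < δ ∧ δ ≤ 1 / (k + 1) ∧
        tsupport f'.1 ⊆ tsupport f.1 ∧
        (∀ x ∈ tsupport f'.1, ∃ l : ℤ,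
          |inner ℝ (e (Nat.unpair k).1) x - l * (2 * δ ^ α k)| ≤ δ) ∧
        ∀ x ∈ tsupport f'.1, ∀ y ∈ tsupport f'.1,
          1 < φ (Nat.unpair k).2 x → φ (Nat.unpair k).2 y < 0 →
          inner ℝ (e (Nat.unpair k).1) x ≠ inner ℝ (e (Nat.unpair k).1) y := fun k f => by
    obtain ⟨δ, f', h1, h2, h3, h4, h5, h6⟩ := f.2.exists_refinement hK (hα0 k) (hα1 k) hp0 (hαp k)
      hm.le (he (Nat.unpair k).1) (hφ (Nat.unpair k).2) (ε := 1 / (k + 1)) (by positivity)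
    exact ⟨δ, ⟨f', h3⟩, h1, h2, h4, h5, h6⟩
  choose δ next hδ0 hδ1 hsub hslab hsep using hstep
  let F : ℕ → {f : E → ℝ≥0 // IsFrostmanDensity K p A m f} :=
    fun k => Nat.rec ⟨f₀, hf₀⟩ (fun k f => next k f) k
  have hmono : ∀ k, tsupport (F (k + 1)).1 ⊆ tsupport (F k).1 := fun k => hsub k (F k)
  have hΓk : ∀ k, ⋂ k, tsupport (F k).1 ⊆ tsupport (next k (F k)).1 :=
    fun k => iInter_subset _ (k + 1)
  have hΓK : ⋂ k, tsupport (F k).1 ⊆ K := (iInter_subset _ 0).trans (F 0).2.tsupport_subset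
  have hΓ : IsCompact (⋂ k, tsupport (F k).1) :=
    hK.of_isClosed_subset (isClosed_iInter fun k => isClosed_tsupport _) hΓK
  refine ⟨⋂ k, tsupport (F k).1, hΓK, hΓ,
    le_dimH_of_frostman hK hm (fun k => (F k).2) hmono, fun n => ⟨fun x hx y hy hxy => ?_, ?_⟩⟩
  · by_contra hne
    obtain ⟨j, hj1, hj2⟩ := hφsep x y hne
    have h1 := hsep (Nat.pair n j) (F (Nat.pair n j)) x (hΓk _ hx) y (hΓk _ hy)
    rw [Nat.unpair_pair] at h1
    exact h1 hj1 hj2 hxy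
  · have hpair : Tendsto (fun j => Nat.pair n j) atTop atTop :=
      tendsto_atTop_mono (fun j => Nat.right_le_pair n j) tendsto_id
    have hinv : Tendsto (fun k : ℕ => 1 / ((k : ℝ) + 1)) atTop (𝓝 0) :=
      tendsto_one_div_add_atTop_nhds_zero_nat
    refine dimH_le_of_forall_exists_int (α := fun j => α (Nat.pair n j))
      (δ := fun j => δ (Nat.pair n j) (F (Nat.pair n j)))
      (hΓ.image (by fun_prop)).isBounded (by linarith) (fun j => hδ0 _ _) ?_ (fun j => (hα0 _).le)
      ?_ ?_
    · exact squeeze_zero (fun j => (hδ0 _ _).le) (fun j => hδ1 _ _) (hinv.comp hpair)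
    · have : Tendsto α atTop (𝓝 (max (1 - s) 0)) := tendsto_const_nhds.max hinv
      rw [max_eq_left (by linarith)] at this
      exact this.comp hpair
    · rintro j _ ⟨x, hx, rfl⟩
      have h1 := hslab (Nat.pair n j) (F (Nat.pair n j)) x (hΓk _ hx)
      rw [Nat.unpair_pair] at h1
      exact h1

/-- The fibre inequality is used twice, for w → ℝ (kernel of dimension dim w - 1) and for the
projection (kernel wᗮ); the lower bound on dim Γ leaves no room between them. -/
theorem dimH_orthogonalProjectionOnto_image_eq {Γ : Set E} (hΓ : Bornology.IsBounded Γ) {s : ℝ}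
    (hs : s ∈ Icc (0 : ℝ) 1) (hdim : ENNReal.ofReal (Module.finrank ℝ E - s) ≤ dimH Γ)
    {w : Submodule ℝ E} {e : E} (hew : e ∈ w) (he : ‖e‖ = 1)
    (hline : dimH ((fun x => inner ℝ e x) '' Γ) ≤ ENNReal.ofReal (1 - s)) :
    dimH Γ = ENNReal.ofReal (Module.finrank ℝ E - s) ∧
      dimH (w.orthogonalProjectionOnto '' Γ) = ENNReal.ofReal (Module.finrank ℝ w - s) := by
  have hperp := w.finrank_add_finrank_orthogonal
  have hperp' : (Module.finrank ℝ w : ℝ) + Module.finrank ℝ wᗮ = Module.finrank ℝ E := by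
    exact_mod_cast hperp
  let T : w →ₗ[ℝ] ℝ := (innerSL ℝ e).toLinearMap ∘ₗ w.subtype
  have hTe : T ⟨e, hew⟩ = 1 := by simp [T, he]
  have hTs : Function.Surjective T := fun c => ⟨c • ⟨e, hew⟩, by rw [map_smul, hTe]; simp⟩
  have hker : 1 + Module.finrank ℝ (LinearMap.ker T) = Module.finrank ℝ w := by
    have := T.finrank_range_add_finrank_ker
    rwa [LinearMap.range_eq_top.2 hTs, finrank_top, Module.finrank_self] at this
  have hker' : 1 + (Module.finrank ℝ (LinearMap.ker T) : ℝ) = Module.finrank ℝ w := by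
    exact_mod_cast hker
  have himage : T '' (w.orthogonalProjectionOnto '' Γ) = (fun x => inner ℝ e x) '' Γ := by
    rw [image_image]
    refine image_congr fun x _ => ?_
    exact w.inner_orthogonalProjectionOnto_eq_of_mem_left ⟨e, hew⟩ x
  have hupper : dimH (w.orthogonalProjectionOnto '' Γ) ≤
      ENNReal.ofReal (Module.finrank ℝ w - s) := by
    refine (dimH_le_dimH_image_add_finrank_ker T
      (w.orthogonalProjectionOnto.lipschitz.isBounded_image hΓ)).trans ?_
    rw [himage, ← hker', ← ENNReal.ofReal_natCast]
    refine (add_le_add_left hline _).trans ?_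
    rw [← ENNReal.ofReal_add (by linarith [hs.2]) (by positivity)]
    exact ENNReal.ofReal_le_ofReal (by linarith)
  have hfiber : dimH Γ ≤ dimH (w.orthogonalProjectionOnto '' Γ) + Module.finrank ℝ wᗮ := by
    have := dimH_le_dimH_image_add_finrank_ker w.orthogonalProjectionOnto.toLinearMap hΓ
    rwa [w.ker_orthogonalProjectionOnto] at this
  have hw1 : (1 : ℝ) ≤ Module.finrank ℝ w := by rw [← hker']; simp
  have hsplit : ENNReal.ofReal (Module.finrank ℝ E - s) =
      ENNReal.ofReal (Module.finrank ℝ w - s) + Module.finrank ℝ wᗮ := by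
    rw [← ENNReal.ofReal_natCast, ← ENNReal.ofReal_add (by linarith [hs.2]) (by positivity),
      ← hperp']
    congr 1; ring
  refine ⟨le_antisymm (hfiber.trans ?_) hdim, le_antisymm hupper ?_⟩
  · rw [hsplit]; gcongr
  · have := hdim.trans hfiber
    rw [hsplit] at this
    exact (ENNReal.add_le_add_iff_right (ENNReal.natCast_ne_top _)).1 this

end Construction

/-! ### The unit cube and the conclusion -/

theorem isCompact_unitCube (d : ℕ) : IsCompact (unitCube d) := by
  have : unitCube d = (EuclideanSpace.equiv (Fin d) ℝ).toHomeomorph ⁻¹'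
      Set.pi univ fun _ => Icc (0 : ℝ) 1 := by
    ext x
    simp only [unitCube, mem_ofPred_eq, mem_preimage, Set.mem_pi, mem_univ, true_imp_iff]
    rfl
  rw [this, Homeomorph.isCompact_preimage]
  exact isCompact_univ_pi fun _ => isCompact_Icc

theorem interior_unitCube_nonempty (d : ℕ) : (interior (unitCube d)).Nonempty := by
  refine ⟨WithLp.toLp 2 fun _ => 1 / 2, mem_interior.2
    ⟨⋂ i, (fun x : EuclideanSpace ℝ (Fin d) => x i) ⁻¹' Ioo 0 1, fun x hx i => ?_, ?_, ?_⟩⟩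
  · exact Ioo_subset_Icc_self (mem_iInter.1 hx i)
  · exact isOpen_iInter_of_finite fun i => isOpen_Ioo.preimage (by fun_prop)
  · simp only [mem_iInter, mem_preimage, mem_Ioo]
    intro i; norm_num

theorem corollary2 (d : ℕ) (hd : 2 ≤ d)
    (W : Set (Submodule ℝ (EuclideanSpace ℝ (Fin d)))) (hW : W.Countable)
    (hW0 : ∀ w ∈ W, w ≠ ⊥)
    (s : ℝ) (hs : s ∈ Set.Icc (0 : ℝ) 1) :
    ∃ Γ : Set (EuclideanSpace ℝ (Fin d)),
      IsCompact Γ ∧ Γ ⊆ unitCube d ∧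
      dimH Γ = ENNReal.ofReal ((d : ℝ) - s) ∧
      ∀ w ∈ W,
        Set.InjOn w.orthogonalProjectionOnto Γ ∧
        dimH (w.orthogonalProjectionOnto '' Γ) =
          ENNReal.ofReal ((Module.finrank ℝ w : ℝ) - s) := by
  have : Nonempty (Fin d) := ⟨⟨0, by omega⟩⟩
  -- Adding `⊤` makes the family nonempty, so it is the range of a sequence and the dimension of Γ
  -- can be read off even when `W` is empty.
  obtain ⟨w, hw⟩ := (hW.insert ⊤).exists_eq_range (insert_nonempty _ _)
  have hw0 : ∀ n, w n ≠ ⊥ := fun n => by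
    have : w n ∈ insert ⊤ W := hw ▸ mem_range_self n
    rcases this with h | h
    · rw [h]; exact top_ne_bot
    · exact hW0 _ h
  have hunit : ∀ n, ∃ e ∈ w n, ‖e‖ = 1 := fun n => by
    obtain ⟨x, hx, hx0⟩ := Submodule.exists_mem_ne_zero_of_ne_bot (hw0 n)
    exact ⟨(‖x‖⁻¹ : ℝ) • x, (w n).smul_mem _ hx, norm_smul_inv_norm hx0⟩
  choose e hew he using hunit
  obtain ⟨Γ, hΓK, hΓ, hdim, hproj⟩ := exists_isCompact_injOn_inner (isCompact_unitCube d)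
    (interior_unitCube_nonempty d) (by rw [finrank_euclideanSpace_fin]; omega) hs he
  have key := fun n => dimH_orthogonalProjectionOnto_image_eq hΓ.isBounded hs hdim (hew n) (he n)
    (hproj n).2
  rw [finrank_euclideanSpace_fin] at key
  refine ⟨Γ, hΓ, hΓK, (key 0).1, fun w' hw' => ?_⟩
  obtain ⟨n, rfl⟩ : w' ∈ range w := hw ▸ mem_insert_of_mem _ hw'
  refine ⟨fun x hx y hy hxy => (hproj n).1 hx hy ?_, (key n).2⟩
  have h1 := (w n).inner_orthogonalProjectionOnto_eq_of_mem_left ⟨e n, hew n⟩ x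
  have h2 := (w n).inner_orthogonalProjectionOnto_eq_of_mem_left ⟨e n, hew n⟩ y
  rw [hxy] at h1
  exact h1.symm.trans h2
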